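/- Work in the real-RAM model: a machine stores real numbers exactly and performs comparisons and the operations $+,-,\times,\div,\sqrt{\cdot},\exp,\log$ on them in unit time; it also has a constant number of index registers, used only for counting and addressing. Let $B_2^d$ be the Euclidean unit ball of $\mathbb{R}^d$. An origin-centered (possibly lower-dimensional) ellipsoid is a set $\mathcal{E}=B\cdot B_2^d$ with $B\in\mathbb{R}^{d\times d}$. There are a single streaming algorithm and absolute constants $C,k$ for which the following holds. Let $d\ge 1$, $n\ge 0$ and $N\ge 0$ be integers, and let $z_1,\dots,z_n\in\mathbb{R}^d$ be points all of whose coordinates are integers in $\{-N,-N+1,\dots,N-1,N\}$. The algorithm is given $d$ (but neither $N$ nor $n$) and receives the points $z_1,\dots,z_n$ one at a time. For every timestep $1\le t\le n$, after receiving $z_1,\dots,z_t$, it maintains an ellipsoid $\mathcal{E}_t=B_t\cdot B_2^d$ (given by the matrix $B_t$), a center $c_t\in\mathbb{R}^d$ and a scaling factor $\alpha_t\in(0,1]$ such that $$c_t+\alpha_t\cdot\mathcal{E}_t\subseteq\mathrm{conv}(\{z_1,\dots,z_t\})\subseteq c_t+\mathcal{E}_t .$$ Let $d_t$ be the dimension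 of the affine span of $z_1,\dots,z_t$. If $d_t\ge 1$ and $dN\ge 2$, then $$\frac{1}{\alpha_t}\le C\, d_t\log(dN),$$ and if $d_t=0$ then $\alpha_t=1$. In particular the bound depends neither on the aspect ratio of the point set nor on the length of the stream. For every $1\le t\le n$ the total running time of the first $t$ steps (including initialization) is at most $C\,t\,d^2(1+\log d)^k$, so the total running time is $\widetilde{O}(nd^2)$, and the algorithm stores at most $C\,d^2$ real numbers, i.e. $O(d^2)$. -/

import Mathlib

open scoped Pointwise

/-!
A uniform random access machine over the real numbers (exact arithmetic, unit cost), described by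
a small structured language. A machine has finitely many index registers, holding natural numbers,
and a memory of real cells. Index registers can only be used for counting and addressing: real
numbers cannot be converted to indices.
-/
namespace RealRAM

/-- Contents of the index registers and of the real memory. -/
structure State where
  reg : ℕ → ℕ
  mem : ℕ → ℝ

/-- Expressions over the index registers; `sub` is truncated subtraction. -/
inductive IExp where
  | lit (n : ℕ)
  | var (r : ℕ)
  | add (e f : IExp)
  | sub (e f : IExp)
  | mul (e f : IExp)

namespace IExp

def eval (σ : State) : IExp → ℕ
  | lit n => n
  | var r => σ.reg r
  | add e f => e.eval σ + f.eval σ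
  | sub e f => e.eval σ - f.eval σ
  | mul e f => e.eval σ * f.eval σ

/-- Number of elementary steps: one for every leaf and every operation. -/
def cost : IExp → ℕ
  | lit _ => 1
  | var _ => 1
  | add e f => e.cost + f.cost + 1
  | sub e f => e.cost + f.cost + 1
  | mul e f => e.cost + f.cost + 1

/-- Every value that occurs in the evaluation fits into an index word, that is, is at most `S`. -/
def Safe (S : ℕ) (σ : State) : IExp → Prop
  | lit n => n ≤ S
  | var r => σ.reg r ≤ S
  | add e f => e.Safe S σ ∧ f.Safe S σ ∧ e.eval σ + f.eval σ ≤ S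
  | sub e f => e.Safe S σ ∧ f.Safe S σ
  | mul e f => e.Safe S σ ∧ f.Safe S σ ∧ e.eval σ * f.eval σ ≤ S

end IExp

/-- Real expressions: natural constants, memory cells, field operations, square root,
exponential and natural logarithm. -/
inductive RExp where
  | const (n : ℕ)
  | cell (a : IExp)
  | add (e f : RExp)
  | sub (e f : RExp)
  | mul (e f : RExp)
  | div (e f : RExp)
  | sqrt (e : RExp)
  | exp (e : RExp)
  | log (e : RExp)

namespace RExp

noncomputable def eval (σ : State) : RExp → ℝ
  | const n => n
  | cell a => σ.mem (a.eval σ)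
  | add e f => e.eval σ + f.eval σ
  | sub e f => e.eval σ - f.eval σ
  | mul e f => e.eval σ * f.eval σ
  | div e f => e.eval σ / f.eval σ
  | sqrt e => Real.sqrt (e.eval σ)
  | exp e => Real.exp (e.eval σ)
  | log e => Real.log (e.eval σ)

def cost : RExp → ℕ
  | const _ => 1
  | cell a => a.cost + 1
  | add e f => e.cost + f.cost + 1
  | sub e f => e.cost + f.cost + 1
  | mul e f => e.cost + f.cost + 1
  | div e f => e.cost + f.cost + 1
  | sqrt e => e.cost + 1
  | exp e => e.cost + 1
  | log e => e.cost + 1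

/-- The evaluation only reads cells with address below `S`, and it never divides by zero, takes the
square root of a negative number or the logarithm of a non-positive number. -/
def Safe (S : ℕ) (σ : State) : RExp → Prop
  | const _ => True
  | cell a => a.Safe S σ ∧ a.eval σ < S
  | add e f => e.Safe S σ ∧ f.Safe S σ
  | sub e f => e.Safe S σ ∧ f.Safe S σ
  | mul e f => e.Safe S σ ∧ f.Safe S σ
  | div e f => e.Safe S σ ∧ f.Safe S σ ∧ f.eval σ ≠ 0
  | sqrt e => e.Safe S σ ∧ 0 ≤ e.eval σ
  | exp e => e.Safe S σ
  | log e => e.Safe S σ ∧ 0 < e.eval σ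

end RExp

/-- Tests: comparison of two indices or of two real numbers, and their Boolean combinations. -/
inductive BExp where
  | idxLT (e f : IExp)
  | realLE (e f : RExp)
  | not (b : BExp)
  | and (b c : BExp)

namespace BExp

def eval (σ : State) : BExp → Prop
  | idxLT e f => e.eval σ < f.eval σ
  | realLE e f => e.eval σ ≤ f.eval σ
  | not b => ¬ b.eval σ
  | and b c => b.eval σ ∧ c.eval σ

def cost : BExp → ℕ
  | idxLT e f => e.cost + f.cost + 1
  | realLE e f => e.cost + f.cost + 1
  | not b => b.cost + 1
  | and b c => b.cost + c.cost + 1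

def Safe (S : ℕ) (σ : State) : BExp → Prop
  | idxLT e f => e.Safe S σ ∧ f.Safe S σ
  | realLE e f => e.Safe S σ ∧ f.Safe S σ
  | not b => b.Safe S σ
  | and b c => b.Safe S σ ∧ c.Safe S σ

end BExp

/-- Commands. -/
inductive Cmd where
  | skip
  | seq (p q : Cmd)
  | assign (r : ℕ) (e : IExp)
  | store (a : IExp) (e : RExp)
  | branch (b : BExp) (p q : Cmd)
  | loop (b : BExp) (p : Cmd)

/-- `Exec S p σ σ' T`: on a machine with `S` real cells (addresses `0, …, S - 1`) whose index
registers hold numbers that are at most `S`, the command `p`, started in `σ`, halts in `σ'` after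
`T` elementary steps and without a fault. -/
inductive Exec (S : ℕ) : Cmd → State → State → ℕ → Prop where
  | skip (σ : State) : Exec S Cmd.skip σ σ 1
  | seq {p q : Cmd} {σ σ₁ σ₂ : State} {T₁ T₂ : ℕ} :
      Exec S p σ σ₁ T₁ → Exec S q σ₁ σ₂ T₂ → Exec S (Cmd.seq p q) σ σ₂ (T₁ + T₂)
  | assign (r : ℕ) (e : IExp) (σ : State) : e.Safe S σ →
      Exec S (Cmd.assign r e) σ ⟨Function.update σ.reg r (e.eval σ), σ.mem⟩ (e.cost + 1)
  | store (a : IExp) (e : RExp) (σ : State) : a.Safe S σ → a.eval σ < S → e.Safe S σ →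
      Exec S (Cmd.store a e) σ ⟨σ.reg, Function.update σ.mem (a.eval σ) (e.eval σ)⟩
        (a.cost + e.cost + 1)
  | branchTrue {b : BExp} {p q : Cmd} {σ σ' : State} {T : ℕ} : b.Safe S σ → b.eval σ →
      Exec S p σ σ' T → Exec S (Cmd.branch b p q) σ σ' (b.cost + 1 + T)
  | branchFalse {b : BExp} {p q : Cmd} {σ σ' : State} {T : ℕ} : b.Safe S σ → ¬ b.eval σ →
      Exec S q σ σ' T → Exec S (Cmd.branch b p q) σ σ' (b.cost + 1 + T)
  | loopDone {b : BExp} {p : Cmd} {σ : State} : b.Safe S σ → ¬ b.eval σ →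
      Exec S (Cmd.loop b p) σ σ (b.cost + 1)
  | loopStep {b : BExp} {p : Cmd} {σ σ₁ σ₂ : State} {T₁ T₂ : ℕ} : b.Safe S σ → b.eval σ →
      Exec S p σ σ₁ T₁ → Exec S (Cmd.loop b p) σ₁ σ₂ T₂ →
      Exec S (Cmd.loop b p) σ σ₂ (b.cost + 1 + T₁ + T₂)

end RealRAM

open RealRAM

/-- A streaming algorithm: one program that is run before the stream starts, and one that is run
after the arrival of every point. It is the same pair of programs for all dimensions and streams. -/
structure StreamAlgorithm where
  init : Cmd
  update : Cmd

namespace StreamAlgorithm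

/-- Initially index register `0` holds the dimension and everything else is `0`. -/
def start (d : ℕ) : State where
  reg r := if r = 0 then d else 0
  mem _ := 0

/-- The arriving point overwrites the cells `0, …, d - 1`. -/
def receive {d : ℕ} (x : EuclideanSpace ℝ (Fin d)) (σ : State) : State where
  reg := σ.reg
  mem a := if h : a < d then x ⟨a, h⟩ else σ.mem a

/-- The scaling factor, held in cell `d`. -/
def scaling (d : ℕ) (σ : State) : ℝ := σ.mem d

/-- The center, held in the cells `d + 1, …, 2d`. -/
noncomputable def center (d : ℕ) (σ : State) : EuclideanSpace ℝ (Fin d) :=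
  WithLp.toLp 2 fun j => σ.mem (d + 1 + j)

/-- The matrix that represents the ellipsoid, held row by row in the `d ^ 2` cells from `2d + 1`
on. -/
def shape (d : ℕ) (σ : State) : Matrix (Fin d) (Fin d) ℝ :=
  Matrix.of fun i j => σ.mem (2 * d + 1 + (i * d + j))

/-- `P.IsRun S z s τ`: with `S` real memory cells, `P` processes the stream `z` without a fault;
`s t` is the state after the first `t` points, `τ 0` is the number of steps of the initialization
and `τ t` the number of steps spent on the `t`-th point. -/
structure IsRun (P : StreamAlgorithm) (S : ℕ) {d n : ℕ} (z : Fin n → EuclideanSpace ℝ (Fin d))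
    (s : ℕ → State) (τ : ℕ → ℕ) : Prop where
  fits : (d + 1) ^ 2 ≤ S
  init : Exec S P.init (start d) (s 0) (τ 0)
  update : ∀ i : Fin n, Exec S P.update (receive (z i) (s i)) (s (i + 1)) (τ (i + 1))

end StreamAlgorithm

/-- The origin-centered, possibly lower-dimensional, ellipsoid `B · B₂ᵈ`. -/
noncomputable def ellipsoid {d : ℕ} (B : Matrix (Fin d) (Fin d) ℝ) :
    Set (EuclideanSpace ℝ (Fin d)) :=
  Matrix.toEuclideanLin B '' Metric.closedBall 0 1

/-- The first `t` points of the stream. -/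
def firstPoints {d n : ℕ} (z : Fin n → EuclideanSpace ℝ (Fin d)) (t : ℕ) :
    Set (EuclideanSpace ℝ (Fin d)) :=
  {x | ∃ i : Fin n, (i : ℕ) < t ∧ z i = x}

/-- The dimension of the affine span of the first `t` points. -/
noncomputable def affineDim {d n : ℕ} (z : Fin n → EuclideanSpace ℝ (Fin d)) (t : ℕ) : ℕ :=
  Module.finrank ℝ (affineSpan ℝ (firstPoints z t)).direction

/-! The algorithm keeps a center c, a matrix B with m independent columns (the axes, spanning the
direction of the affine hull) and a factor α. Let y = z - c for the arriving point z. If z lies in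
the outer ellipsoid, nothing changes. If z lies in the affine hull but outside, at distance r > 1 in
the coordinates that make the outer ellipsoid a unit ball, the ellipsoid is stretched by r towards z
and by b = 1 + α(1 - 1/r) across, and 1/α grows by 4(1 - 1/r) ≤ 4 log r. If z leaves the affine
hull, y becomes an additional axis, the old axes grow by 1 + α, and 1/α grows by 12; this happens
once for every dimension.

Independence of aspect ratio and stream length comes from a determinant potential. Write B = Y T
with Y an integer matrix. A stretch multiplies det T by r b^(m-1) ≥ r, and a new axis does not
decrease it, so 1/α ≤ 1 + 12m + 4 log det T is an invariant. Conversely det(BᵀB) = (det T)²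
det(YᵀY), and det(YᵀY) is a positive integer, so (det T)² ≤ det(BᵀB). Since c ± αBe_j lie in the
convex hull, the entries of B are at most N/α. Hence log det T ≤ m (log(dN) + log(1/α)), and the
resulting inequality for 1/α is solved because the logarithm grows slower than any linear function.

The Moore-Penrose inverse G of B is maintained too. It yields the coordinates u = Gy and the
residual v = y - Bu, hence the case distinction, and every update of B and G is a scaling, a
rank-one correction or an appended row or column. Each point therefore costs O(d²) steps, without a
logarithmic factor.

The geometry is in `exists_shift_add_stretch`, `mem_of_stretch`, `exists_cone_base` and
`mem_of_cone`; the potential in `Rounding.insert_stretch`, `Rounding.insert_append`,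
`Rounding.det_sq_le` and `Rounding.one_div_le`; the machine in `run_update`. -/

namespace EllipsoidUpdate

/-- The scaling factor after stretching by `r` in one direction. -/
noncomputable def shrink (α r : ℝ) : ℝ := α / (1 + 4 * α * (1 - 1 / r))

/-- The distance by which the center moves in the stretched direction. -/
noncomputable def shift (α r : ℝ) : ℝ := shrink α r * r - α

/-- The stretching factor of the orthogonal directions. -/
noncomputable def widen (α r : ℝ) : ℝ := 1 + α * (1 - 1 / r)

/-! ### Inequalities between the parameters of a stretch. -/

section Parameters

variable {α r : ℝ}

theorem one_sub_inv_pos (hr : 1 < r) : 0 < 1 - 1 / r := by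
  have : 1 / r < 1 := by rw [div_lt_one (by linarith)]; exact hr
  linarith

theorem one_sub_inv_lt_one (hr : 1 < r) : 1 - 1 / r < 1 := by
  have : 0 < 1 / r := by positivity
  linarith

theorem shrink_pos (hα : 0 < α) (hr : 1 < r) : 0 < shrink α r := by
  have := one_sub_inv_pos hr
  unfold shrink; positivity

theorem shrink_le (hα : 0 < α) (hr : 1 < r) : shrink α r ≤ α := by
  have h := one_sub_inv_pos hr
  unfold shrink
  apply div_le_self hα.le
  have : 0 < 4 * α * (1 - 1 / r) := by positivity
  linarith

/-- `shrink` is designed for this additive growth, which 4 log r dominates. -/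
theorem one_div_shrink (hα : 0 < α) : 1 / shrink α r = 1 / α + 4 * (1 - 1 / r) := by
  unfold shrink
  rw [one_div_div, add_div]
  field_simp

theorem one_lt_widen (hα : 0 < α) (hr : 1 < r) : 1 < widen α r := by
  have h := one_sub_inv_pos hr
  have : 0 < α * (1 - 1 / r) := by positivity
  unfold widen; linarith

theorem shift_eq (hα : 0 < α) (hr : 1 < r) :
    shift α r = α * (r - 1) * (1 - 4 * α / r) / (1 + 4 * α * (1 - 1 / r)) := by
  have h := one_sub_inv_pos hr
  have h2 : 0 < 1 + 4 * α * (1 - 1 / r) := by positivity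
  unfold shift shrink
  rw [eq_div_iff h2.ne']
  have : r ≠ 0 := by linarith
  have e : α / (1 + 4 * α * (1 - 1 / r)) * r * (1 + 4 * α * (1 - 1 / r)) = α * r := by
    rw [mul_right_comm, div_mul_cancel₀ _ h2.ne']
  rw [sub_mul, e]
  field_simp
  ring

theorem shift_nonneg (hα : 0 < α) (hα' : α ≤ 1 / 12) (hr : 1 < r) : 0 ≤ shift α r := by
  rw [shift_eq hα hr]
  have h := one_sub_inv_pos hr
  have h1 : 4 * α / r ≤ 1 := by rw [div_le_one (by linarith)]; linarith
  have h2 : 0 ≤ 1 - 4 * α / r := by linarith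
  have h3 : 0 ≤ r - 1 := by linarith
  positivity

theorem shift_le (hα : 0 < α) (hr : 1 < r) :
    shift α r ≤ α * (r - 1) := by
  have := mul_le_mul_of_nonneg_right (shrink_le hα hr) (by linarith : (0 : ℝ) ≤ r)
  unfold shift; nlinarith [shrink_le hα hr]

theorem widen_sub_one_le (hα : 0 < α) (hα' : α ≤ 1 / 12) (hr : 1 < r) :
    widen α r - 1 ≤ (r - 1) / 12 := by
  unfold widen
  have h : 1 - 1 / r ≤ r - 1 := by
    have : r ≠ 0 := by linarith
    have e : r - 1 - (1 - 1 / r) = (r - 1) ^ 2 / r := by field_simp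
    have : 0 ≤ (r - 1) ^ 2 / r := by positivity
    linarith
  have h0 := one_sub_inv_pos hr
  nlinarith

/-- The discriminant condition for the stretched, shifted ellipsoid to contain the unit ball. The
left side is at most 2α²(r - 1)², the right side at least 2α(r - 1)². -/
theorem shift_sq_mul_le (hα : 0 < α) (hα' : α ≤ 1 / 12) (hr : 1 < r) :
    shift α r ^ 2 * widen α r ^ 2 ≤ (widen α r ^ 2 - 1) * (r ^ 2 - widen α r ^ 2) := by
  have hq0 := shift_nonneg hα hα' hr
  have hq := shift_le hα hr
  have hb := one_lt_widen hα hr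
  have hb' := widen_sub_one_le hα hα' hr
  have hb2 : widen α r ^ 2 ≤ 2 := by
    have : widen α r ≤ 1 + 1 / 12 := by
      unfold widen
      nlinarith [one_sub_inv_lt_one hr, one_sub_inv_pos hr]
    nlinarith
  have h1 : shift α r ^ 2 * widen α r ^ 2 ≤ (α * (r - 1)) ^ 2 * 2 := by gcongr
  have h2 : 2 * α * (1 - 1 / r) ≤ widen α r ^ 2 - 1 := by
    have : widen α r ^ 2 - 1 = 2 * α * (1 - 1 / r) + (α * (1 - 1 / r)) ^ 2 := by
      unfold widen; ring
    nlinarith [sq_nonneg (α * (1 - 1 / r))]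
  have h3 : (r - 1) * r ≤ r ^ 2 - widen α r ^ 2 := by nlinarith
  have h4 : (2 * α * (1 - 1 / r)) * ((r - 1) * r) = 2 * α * (r - 1) ^ 2 := by
    have : r ≠ 0 := by linarith
    field_simp
  have h0 := one_sub_inv_pos hr
  have h5 : (2 * α * (1 - 1 / r)) * ((r - 1) * r) ≤
      (widen α r ^ 2 - 1) * (r ^ 2 - widen α r ^ 2) := by
    apply mul_le_mul h2 h3
    · nlinarith
    · nlinarith
  have h6 : (α * (r - 1)) ^ 2 * 2 ≤ 2 * α * (r - 1) ^ 2 := by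
    have : 0 ≤ α * (r - 1) ^ 2 := by positivity
    nlinarith
  linarith

theorem shift_div_le (hα : 0 < α) (hα' : α ≤ 1 / 12) (hr : 1 < r) :
    shift α r / (r - α) ≤ 2 * α * (1 - 1 / r) := by
  have h := shift_le hα hr
  have h0 := one_sub_inv_pos hr
  rw [div_le_iff₀ (by linarith)]
  have e : r - 1 = r * (1 - 1 / r) := by have : r ≠ 0 := by linarith
                                         field_simp
  have : 0 ≤ α * (1 - 1 / r) := by positivity
  rw [e] at h
  nlinarith

/-- Controls the directions orthogonal to the stretch in `mem_of_stretch`. -/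
theorem shrink_mul_widen_sq_le (hα : 0 < α) (hα' : α ≤ 1 / 12) (hr : 1 < r) :
    (shrink α r * widen α r) ^ 2 ≤ α ^ 2 * (1 - 2 * (shift α r / (r - α))) := by
  have hl := shift_div_le hα hα' hr
  have h0 := one_sub_inv_pos hr
  have h1 := one_sub_inv_lt_one hr
  set y := α * (1 - 1 / r) with hy
  have hy0 : 0 < y := by positivity
  have hy1 : y ≤ 1 / 12 := by nlinarith
  have e1 : shrink α r * widen α r = α * ((1 + y) / (1 + 4 * y)) := by
    unfold shrink widen; rw [← hy, show 4 * α * (1 - 1 / r) = 4 * y by rw [hy]; ring]; ring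
  rw [e1, mul_pow]
  apply mul_le_mul_of_nonneg_left _ (by positivity)
  -- For y > 0 this amounts to 17y + 64y² ≤ 2, which y ≤ 1/12 ensures with little room.
  have h2 : ((1 + y) / (1 + 4 * y)) ^ 2 ≤ 1 - 4 * y := by
    rw [div_pow, div_le_iff₀ (by positivity)]
    nlinarith [mul_pos hy0 hy0]
  have : 2 * α * (1 - 1 / r) = 2 * y := by rw [hy]; ring
  linarith

end Parameters

/-! ### A point in the affine hull: stretching in one direction. -/

section Regular

variable {F V : Type*} [NormedAddCommGroup F] [InnerProductSpace ℝ F] [AddCommGroup V] [Module ℝ V]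

/-- The linear map that multiplies the direction of the unit vector `w` by `a` and its orthogonal
complement by `b`. -/
noncomputable def stretch (a b : ℝ) (w v : F) : F := b • v + ((a - b) * inner ℝ w v) • w

theorem norm_sq_smul_add_smul {w : F} (hw : ‖w‖ = 1) (v : F) (β κ : ℝ) :
    ‖β • v + κ • w‖ ^ 2 =
      β ^ 2 * (‖v‖ ^ 2 - inner ℝ w v ^ 2) + (β * inner ℝ w v + κ) ^ 2 := by
  rw [norm_add_sq_real, norm_smul, norm_smul, hw, inner_smul_left, inner_smul_right,
    real_inner_comm, mul_pow, mul_pow, Real.norm_eq_abs, Real.norm_eq_abs, sq_abs, sq_abs]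
  simp
  ring

theorem inner_sq_le_norm_sq {w : F} (hw : ‖w‖ = 1) (v : F) : inner ℝ w v ^ 2 ≤ ‖v‖ ^ 2 := by
  have h := abs_real_inner_le_norm w v
  rw [hw, one_mul] at h
  exact sq_le_sq' (by linarith [abs_le.1 h]) (le_of_abs_le h)

theorem stretch_add_smul {w : F} (hw : ‖w‖ = 1) {a b : ℝ} (ha : a ≠ 0) (hb : b ≠ 0) (v : F) :
    stretch a b w ((1 / b) • v + ((1 / a - 1 / b) * inner ℝ w v) • w) = v := by
  unfold stretch
  rw [inner_add_right, inner_smul_right, inner_smul_right, real_inner_self_eq_norm_sq, hw,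
    smul_add, smul_smul, smul_smul, add_assoc, ← add_smul, mul_one_div_cancel hb, one_smul]
  convert add_zero v
  convert zero_smul ℝ w
  field_simp
  ring

/-- The old outer ball stays covered. If s is the w-coordinate of u and q the shift, the preimage
has squared norm (‖u‖² - s²)/b² + (s - q)²/r². With ‖u‖ ≤ 1 this is bounded by a quadratic in s,
which is at most 1 by the discriminant condition `shift_sq_mul_le`. -/
theorem exists_shift_add_stretch {w : F} (hw : ‖w‖ = 1) {α r : ℝ} (hα : 0 < α)
    (hα' : α ≤ 1 / 12) (hr : 1 < r) {u : F} (hu : ‖u‖ ≤ 1) :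
    ∃ v : F, ‖v‖ ≤ 1 ∧ u = shift α r • w + stretch r (widen α r) w v := by
  have hb := one_lt_widen hα hr
  have hkey := shift_sq_mul_le hα hα' hr
  have hbr := widen_sub_one_le hα hα' hr
  set q := shift α r
  set b := widen α r
  refine ⟨(1 / b) • (u - q • w) + ((1 / r - 1 / b) * inner ℝ w (u - q • w)) • w, ?_, ?_⟩
  · have h1 : ‖u - q • w‖ ^ 2 = ‖u‖ ^ 2 - inner ℝ w u ^ 2 + (inner ℝ w u - q) ^ 2 := by
      have := norm_sq_smul_add_smul hw u 1 (-q)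
      rw [one_smul, neg_smul, ← sub_eq_add_neg] at this
      rw [this]; ring
    have h2 : inner ℝ w (u - q • w) = inner ℝ w u - q := by
      rw [inner_sub_right, inner_smul_right, real_inner_self_eq_norm_sq, hw]; ring
    have h3 := norm_sq_smul_add_smul hw (u - q • w) (1 / b)
      ((1 / r - 1 / b) * inner ℝ w (u - q • w))
    rw [h1, h2] at h3
    have hs := inner_sq_le_norm_sq hw u
    have hu2 : ‖u‖ ^ 2 ≤ 1 := by nlinarith [norm_nonneg u]
    generalize inner ℝ w u = s at *
    rw [← sq_le_one_iff₀ (norm_nonneg _), h2, h3]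
    have e : (1 / b) ^ 2 * (‖u‖ ^ 2 - s ^ 2 + (s - q) ^ 2 - (s - q) ^ 2) +
        (1 / b * (s - q) + (1 / r - 1 / b) * (s - q)) ^ 2 =
        ((‖u‖ ^ 2 - s ^ 2) * r ^ 2 + (s - q) ^ 2 * b ^ 2) / (b ^ 2 * r ^ 2) := by
      have : b ≠ 0 := by linarith
      have : r ≠ 0 := by linarith
      field_simp
      ring
    rw [e, div_le_one (by positivity)]
    have hA : 0 < r ^ 2 - b ^ 2 := by nlinarith
    -- Multiplying by r² - b² > 0 allows completing the square in s.
    have h5 : 0 ≤ (r ^ 2 - b ^ 2) *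
        (b ^ 2 * r ^ 2 - ((1 - s ^ 2) * r ^ 2 + (s - q) ^ 2 * b ^ 2)) := by
      have : (r ^ 2 - b ^ 2) * (b ^ 2 * r ^ 2 - ((1 - s ^ 2) * r ^ 2 + (s - q) ^ 2 * b ^ 2)) =
        ((r ^ 2 - b ^ 2) * s + q * b ^ 2) ^ 2 +
          r ^ 2 * ((b ^ 2 - 1) * (r ^ 2 - b ^ 2) - q ^ 2 * b ^ 2) := by ring
      rw [this]
      have : 0 ≤ (b ^ 2 - 1) * (r ^ 2 - b ^ 2) - q ^ 2 * b ^ 2 := by linarith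
      positivity
    have h6 := nonneg_of_mul_nonneg_right h5 hA
    nlinarith [mul_le_mul_of_nonneg_right hu2 (sq_nonneg r)]
  · rw [stretch_add_smul hw (by linarith) (by linarith)]; abel

theorem exists_shift_add_stretch_tip {w : F} (hw : ‖w‖ = 1) {α r : ℝ} (hα : 0 < α)
    (hα' : α ≤ 1 / 12) (hr : 1 < r) :
    ∃ v : F, ‖v‖ ≤ 1 ∧ r • w = shift α r • w + stretch r (widen α r) w v := by
  have h0 := shift_nonneg hα hα' hr
  have h1 := shift_le hα hr
  refine ⟨((r - shift α r) / r) • w, ?_, ?_⟩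
  · rw [norm_smul, hw, mul_one, Real.norm_eq_abs, abs_le, le_div_iff₀ (by linarith),
      div_le_one (by linarith)]
    constructor <;> nlinarith
  · unfold stretch
    rw [inner_smul_right, real_inner_self_eq_norm_sq, hw, smul_smul, ← add_smul, ← add_smul]
    congr 1
    have : r ≠ 0 := by linarith
    field_simp
    ring

/-- The new inner ellipsoid lies in the convex hull of the old inner ball of radius α and the tip
rw. Each of its points is split as p + θrw with ‖p‖ ≤ α(1 - θ). The w-coordinate of p is computed
exactly, the orthogonal part is bounded by `shrink_mul_widen_sq_le`, and the squares add up to (α(1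
- θ))² at most. -/
theorem mem_of_stretch {K : Set V} (hK : Convex ℝ K) (L : F →ₗ[ℝ] V) {c : V} {w : F}
    (hw : ‖w‖ = 1) {α r : ℝ} (hα : 0 < α) (hα' : α ≤ 1 / 12) (hr : 1 < r)
    (hin : ∀ x : F, ‖x‖ ≤ 1 → c + α • L x ∈ K) (htip : c + L (r • w) ∈ K) {v : F}
    (hv : ‖v‖ ≤ 1) :
    c + L (shift α r • w) + shrink α r • L (stretch r (widen α r) w v) ∈ K := by
  have hq0 := shift_nonneg hα hα' hr
  have hl := shift_div_le hα hα' hr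
  have hkey := shrink_mul_widen_sq_le hα hα' hr
  have hq : shrink α r * r = α + shift α r := by unfold shift; ring
  set b := widen α r
  set q := shift α r
  set α' := shrink α r
  have hrα : 0 < r - α := by linarith
  set l := q / (r - α) with hldef
  have hl0 : 0 ≤ l := by positivity
  have hl1 : l ≤ 1 / 6 := by
    nlinarith [one_sub_inv_lt_one hr, one_sub_inv_pos hr]
  have hlq : q = l * (r - α) := by rw [hldef]; field_simp
  set x := inner ℝ w v with hx
  have hv2 : ‖v‖ ^ 2 ≤ 1 := by nlinarith [norm_nonneg v]
  have hx2 : x ^ 2 ≤ ‖v‖ ^ 2 := inner_sq_le_norm_sq hw v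
  have hx1 := abs_le.1 ((sq_le_one_iff_abs_le_one x).1 (hx2.trans hv2))
  -- The weight of the tip is affine in x. It vanishes at x = -1, where the new inner ellipsoid
  -- touches the old ball at -αw because α'r = α + q. At x = 1 the far end α + 2q equals (1 - 2l)α +
  -- 2lr.
  set θ := l * (1 + x) with hθ
  have hθ0 : 0 ≤ θ := mul_nonneg hl0 (by linarith)
  have hθ1 : θ < 1 := by nlinarith
  set p : F := (α' * b) • v + (q + α' * (r - b) * x - θ * r) • w with hp
  have hpn : ‖p‖ ≤ α * (1 - θ) := by
    have h := norm_sq_smul_add_smul hw v (α' * b) (q + α' * (r - b) * x - θ * r)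
    rw [← hp, ← hx] at h
    have e : α' * b * x + (q + α' * (r - b) * x - θ * r) = α * (-1 + (1 + x) * (1 - l)) := by
      have : α' * b * x + (q + α' * (r - b) * x - θ * r) = q + (α' * r) * x - θ * r := by ring
      rw [this, hq, hθ, hlq]; ring
    rw [e] at h
    apply le_of_sq_le_sq _ (by nlinarith) 
    rw [h]
    have h7 : (α' * b) ^ 2 * (‖v‖ ^ 2 - x ^ 2) ≤ α ^ 2 * (1 - 2 * l) * (1 - x ^ 2) := by
      apply mul_le_mul hkey (by linarith) (by linarith)
      apply mul_nonneg (by positivity); linarith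
    have h8 : α ^ 2 * (1 - 2 * l) * (1 - x ^ 2) + (α * (-1 + (1 + x) * (1 - l))) ^ 2 =
        (α * (1 - θ)) ^ 2 := by rw [hθ]; ring
    linarith
  have hden : 0 < α * (1 - θ) := mul_pos hα (by linarith)
  have hmem := hin ((α * (1 - θ))⁻¹ • p) (by
    rw [norm_smul, norm_inv, Real.norm_of_nonneg hden.le, inv_mul_le_one₀ hden]; exact hpn)
  have hcomb := hK hmem htip (by linarith : (0 : ℝ) ≤ 1 - θ) hθ0 (by ring)
  convert hcomb using 1
  have e1 : (1 - θ) • α • L ((α * (1 - θ))⁻¹ • p) = L p := by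
    rw [map_smul, smul_smul, smul_smul]
    convert one_smul ℝ (L p)
    have : 1 - θ ≠ 0 := by linarith
    field_simp
  rw [smul_add (1 - θ) c, smul_add θ c, e1, hp, stretch, ← hx]
  simp only [map_add, map_smul]
  module

end Regular

/-! ### A point outside the affine hull: adding an axis. -/

section Irregular

variable {F V : Type*} [NormedAddCommGroup F] [InnerProductSpace ℝ F] [AddCommGroup V] [Module ℝ V]

/-- The center moves by α' = α/(1 + 12α) along the new axis, so the old ellipsoid sits at height
-α'. Widening by 1 + α makes room for it, since 1/(1 + α)² ≤ 1 - α/4 and α'² ≤ α/4. -/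
theorem exists_cone_base {α : ℝ} (hα : 0 < α) (hα' : α ≤ 1) {u : F} (hu : ‖u‖ ≤ 1) :
    ∃ (v : F) (ξ : ℝ), ‖v‖ ^ 2 + ξ ^ 2 ≤ 1 ∧ u = (1 + α) • v ∧ 0 = α / (1 + 12 * α) + ξ := by
  refine ⟨(1 / (1 + α)) • u, -(α / (1 + 12 * α)), ?_, ?_, by ring⟩
  · rw [norm_smul, Real.norm_of_nonneg (by positivity), mul_pow, neg_sq]
    have h1 : ‖u‖ ^ 2 ≤ 1 := by nlinarith [norm_nonneg u]
    have h2 : (1 / (1 + α)) ^ 2 * ‖u‖ ^ 2 ≤ (1 / (1 + α)) ^ 2 * 1 := by gcongr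
    have h3 : (1 / (1 + α)) ^ 2 ≤ 1 - α / 4 := by
      rw [div_pow, div_le_iff₀ (by positivity)]
      nlinarith [mul_pos hα hα]
    have h4 : (α / (1 + 12 * α)) ^ 2 ≤ α / 4 := by
      rw [div_pow, div_le_iff₀ (by positivity)]
      nlinarith [mul_pos hα hα]
    linarith
  · rw [smul_smul, mul_one_div_cancel (by positivity), one_smul]

/-- The coefficient of y is θ = α'(1 + ξ), which lies between 0 and 2α', so θ is the weight of the
tip. The rest lies in the base scaled by 1 - θ because α'(1 + α) ≤ α(1 - 2α'). The constant 12 also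
makes α' ≤ 1/12, as later stretches need. -/
theorem mem_of_cone {K : Set V} (hK : Convex ℝ K) (L : F →ₗ[ℝ] V) {c y : V} {α : ℝ}
    (hα : 0 < α) (hin : ∀ x : F, ‖x‖ ≤ 1 → c + α • L x ∈ K) (htip : c + y ∈ K)
    {v : F} {ξ : ℝ} (hv : ‖v‖ ^ 2 + ξ ^ 2 ≤ 1) :
    c + (α / (1 + 12 * α)) • y + (α / (1 + 12 * α)) • (L ((1 + α) • v) + ξ • y) ∈ K := by
  set α' := α / (1 + 12 * α) with hdef
  have h0 : 0 < α' := by positivity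
  have h1 : α' * (1 + 12 * α) = α := by rw [hdef]; field_simp
  have h2 : α' ≤ 1 / 12 := by rw [hdef, div_le_iff₀ (by positivity)]; linarith
  have hξ := abs_le.1 ((sq_le_one_iff_abs_le_one ξ).1 (by nlinarith [sq_nonneg ‖v‖]))
  have hvn : ‖v‖ ≤ 1 := by
    rw [← sq_le_one_iff₀ (norm_nonneg _)]; nlinarith
  set θ := α' * (1 + ξ) with hθ
  have hθ0 : 0 ≤ θ := mul_nonneg h0.le (by linarith)
  have hθ1 : θ ≤ 2 * α' := by nlinarith
  have hden : 0 < α * (1 - θ) := mul_pos hα (by linarith)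
  have hmem := hin ((α * (1 - θ))⁻¹ • (α' * (1 + α)) • v) (by
    rw [norm_smul, norm_inv, Real.norm_of_nonneg hden.le, inv_mul_le_one₀ hden, norm_smul,
      Real.norm_of_nonneg (by positivity)]
    have : α' * (1 + α) * ‖v‖ ≤ α' * (1 + α) * 1 := by gcongr
    have h3 : α' * (1 + α) ≤ α * (1 - 2 * α') := by nlinarith
    nlinarith)
  have hcomb := hK hmem htip (by linarith : (0 : ℝ) ≤ 1 - θ) hθ0 (by ring)
  convert hcomb using 1
  have e1 : (1 - θ) • α • L ((α * (1 - θ))⁻¹ • (α' * (1 + α)) • v) = (α' * (1 + α)) • L v := by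
    rw [map_smul, map_smul, smul_smul, smul_smul]
    convert one_smul ℝ ((α' * (1 + α)) • L v)
    have : 1 - θ ≠ 0 := by linarith
    field_simp
  rw [smul_add (1 - θ) c, smul_add θ c, e1, hθ]
  simp only [map_smul]
  module

end Irregular

/-! ### The invariant in matrix form. -/

open Matrix

variable {d m : ℕ}

/-- `Rounding Z c B G α`: the columns of `B` span the direction of the affine span of the integer
points `Z`, the ellipsoid `c + B` contains `Z`, its copy scaled by `α` lies in the convex hull of
`Z`, and `G` is the Moore-Penrose inverse of `B`. The matrix `T` compares the columns of `B` with a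
family of integer vectors; its determinant bounds `1 / α`. -/
structure Rounding (Z : Set (EuclideanSpace ℝ (Fin d))) (c : EuclideanSpace ℝ (Fin d))
    (B : Matrix (Fin d) (Fin m) ℝ) (G : Matrix (Fin m) (Fin d) ℝ) (α : ℝ) : Prop where
  nonempty : Z.Nonempty
  left_inv : G * B = 1
  -- Together with `left_inv` this makes `B * G` the orthogonal projection onto the column space of
  -- `B`.
  normal : Bᵀ * (B * G) = Bᵀ
  pos : 0 < α
  le_one : α ≤ 1
  eq_one : m = 0 → α = 1
  le_twelfth : m ≠ 0 → α ≤ 1 / 12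
  inner_mem : ∀ x : EuclideanSpace ℝ (Fin m), ‖x‖ ≤ 1 →
    c + α • toEuclideanLin B x ∈ convexHull ℝ Z
  outer_mem : ∀ z ∈ Z, ∃ x : EuclideanSpace ℝ (Fin m), ‖x‖ ≤ 1 ∧ z = c + toEuclideanLin B x
  det_bound : ∃ (Y : Matrix (Fin d) (Fin m) ℤ) (T : Matrix (Fin m) (Fin m) ℝ),
    B = Y.map (fun k : ℤ => (k : ℝ)) * T ∧ 0 < T.det ∧ 1 / α ≤ 1 + 12 * m + 4 * Real.log T.det

/-- The matrix `A` with the column `y` appended. -/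
def appendCol {R : Type*} (A : Matrix (Fin d) (Fin m) R) (y : Fin d → R) :
    Matrix (Fin d) (Fin (m + 1)) R :=
  Matrix.of fun i => Fin.snoc (α := fun _ => R) (A i) (y i)

/-- The matrix `G` with the row `p` appended. -/
def appendRow {R : Type*} (G : Matrix (Fin m) (Fin d) R) (p : Fin d → R) :
    Matrix (Fin (m + 1)) (Fin d) R :=
  Matrix.of (Fin.snoc (α := fun _ => Fin d → R) G p)

section Append

variable {R : Type*}

@[simp] theorem appendCol_castSucc (A : Matrix (Fin d) (Fin m) R) (y : Fin d → R) (i : Fin d)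
    (j : Fin m) : appendCol A y i j.castSucc = A i j := by simp [appendCol]

@[simp] theorem appendCol_last (A : Matrix (Fin d) (Fin m) R) (y : Fin d → R) (i : Fin d) :
    appendCol A y i (Fin.last m) = y i := by simp [appendCol]

@[simp] theorem appendRow_castSucc (A : Matrix (Fin m) (Fin d) R) (y : Fin d → R) (i : Fin m) :
    appendRow A y i.castSucc = A i :=
  Fin.snoc_castSucc (α := fun _ => Fin d → R) y A i

@[simp] theorem appendRow_last (A : Matrix (Fin m) (Fin d) R) (y : Fin d → R) :
    appendRow A y (Fin.last m) = y :=
  Fin.snoc_last (α := fun _ => Fin d → R) y A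

theorem appendCol_mulVec (A : Matrix (Fin d) (Fin m) ℝ) (y : Fin d → ℝ) (x : Fin (m + 1) → ℝ) :
    appendCol A y *ᵥ x = A *ᵥ (fun j => x j.castSucc) + x (Fin.last m) • y := by
  ext i
  simp [mulVec, dotProduct, Fin.sum_univ_castSucc, mul_comm]

end Append

theorem toEuclideanLin_eq {n : ℕ} (B : Matrix (Fin d) (Fin n) ℝ) (x : EuclideanSpace ℝ (Fin n)) :
    toEuclideanLin B x = WithLp.toLp 2 (B *ᵥ x.ofLp) := rfl

theorem dotProduct_self_eq_norm_sq {n : ℕ} (x : EuclideanSpace ℝ (Fin n)) :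
    x.ofLp ⬝ᵥ x.ofLp = ‖x‖ ^ 2 := by
  rw [EuclideanSpace.norm_sq_eq]
  simp [dotProduct, sq]

/-- The matrix of `stretch r b w` for `u = r w`. -/
noncomputable def stretchMatrix (r b : ℝ) (u : Fin m → ℝ) : Matrix (Fin m) (Fin m) ℝ :=
  b • 1 + ((r - b) / r ^ 2) • vecMulVec u u

/-- The inverse of `stretchMatrix`. -/
noncomputable def unstretchMatrix (r b : ℝ) (u : Fin m → ℝ) : Matrix (Fin m) (Fin m) ℝ :=
  (1 / b) • (1 + ((b / r - 1) / r ^ 2) • vecMulVec u u)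

section Stretch

variable {r b : ℝ} {u : Fin m → ℝ}

theorem unstretch_mul_stretch (hr : 0 < r) (hb : 0 < b) (hu : u ⬝ᵥ u = r ^ 2) :
    unstretchMatrix r b u * stretchMatrix r b u = 1 := by
  have h : vecMulVec u u * vecMulVec u u = r ^ 2 • vecMulVec u u := by
    rw [vecMulVec_mul_vecMulVec, hu]
    ext i j
    simp [vecMulVec_apply]
    try ring
  unfold unstretchMatrix stretchMatrix
  simp only [Matrix.smul_mul, Matrix.add_mul, Matrix.mul_add, Matrix.mul_smul, h, Matrix.one_mul,
    Matrix.mul_one, smul_smul, smul_add]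
  generalize vecMulVec u u = U
  have e : ∀ x y z w : ℝ, x = 1 → y + z + w = 0 →
      x • (1 : Matrix (Fin m) (Fin m) ℝ) + z • U + (y • U + w • U) = 1 := by
    intro x y z w h1 h2
    have : x • (1 : Matrix (Fin m) (Fin m) ℝ) + z • U + (y • U + w • U) =
      x • (1 : Matrix (Fin m) (Fin m) ℝ) + (y + z + w) • U := by module
    rw [this, h1, h2]; simp
  have := e (1 / b * b) (1 / b * ((b / r - 1) / r ^ 2) * b) (1 / b * ((r - b) / r ^ 2))
    (1 / b * ((b / r - 1) / r ^ 2) * ((r - b) / r ^ 2) * r ^ 2) (by field_simp)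
    (by field_simp; ring)
  convert this using 1
  module

/-- The eigenvalues are r once and b otherwise; the matrix determinant lemma gives their product. -/
theorem det_stretchMatrix (hr : 0 < r) (hb : 0 < b) (hu : u ⬝ᵥ u = r ^ 2) :
    (stretchMatrix r b u).det = b ^ m * (r / b) := by
  have h : stretchMatrix r b u = b • (1 + replicateCol Unit (((r - b) / (b * r ^ 2)) • u) *
      replicateRow Unit u) := by
    unfold stretchMatrix
    rw [smul_add]
    congr 1
    ext i j
    simp [vecMulVec_apply, Matrix.mul_apply]
    field_simp
  rw [h, det_smul, det_one_add_replicateCol_mul_replicateRow, dotProduct_smul, hu, Fintype.card_fin]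
  congr 1
  simp only [smul_eq_mul]
  field_simp
  ring

end Stretch

/-! ### Preservation of the invariant by the updates. -/

namespace Rounding

variable {Z : Set (EuclideanSpace ℝ (Fin d))} {c : EuclideanSpace ℝ (Fin d)}
  {B : Matrix (Fin d) (Fin m) ℝ} {G : Matrix (Fin m) (Fin d) ℝ} {α : ℝ}

theorem singleton (z : EuclideanSpace ℝ (Fin d)) :
    Rounding (m := 0) {z} z (Matrix.of fun _ j => j.elim0) (Matrix.of fun i => i.elim0) 1 where
  nonempty := Set.singleton_nonempty z
  left_inv := by ext i; exact i.elim0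
  normal := by ext i; exact i.elim0
  pos := one_pos
  le_one := le_rfl
  eq_one _ := rfl
  le_twelfth h := absurd rfl h
  inner_mem x _ := by
    rw [Subsingleton.elim x 0]; simp
  outer_mem y hy := ⟨0, by simp, by simpa using hy⟩
  det_bound := ⟨Matrix.of fun _ j => j.elim0, 1, by ext i j; exact j.elim0, by simp, by simp⟩

theorem insert_of_mem (h : Rounding Z c B G α) {z : EuclideanSpace ℝ (Fin d)}
    {x : EuclideanSpace ℝ (Fin m)} (hx : ‖x‖ ≤ 1) (hz : z = c + toEuclideanLin B x) :
    Rounding (insert z Z) c B G α where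
  nonempty := Set.insert_nonempty z Z
  left_inv := h.left_inv
  normal := h.normal
  pos := h.pos
  le_one := h.le_one
  eq_one := h.eq_one
  le_twelfth := h.le_twelfth
  inner_mem x hx := convexHull_mono (Set.subset_insert z Z) (h.inner_mem x hx)
  outer_mem y hy := by
    rcases hy with rfl | hy
    · exact ⟨x, hx, hz⟩
    · exact h.outer_mem y hy
  det_bound := h.det_bound

theorem insert_stretch (h : Rounding Z c B G α) {z : EuclideanSpace ℝ (Fin d)} {u : Fin m → ℝ}
    {r : ℝ} (hu : (z - c).ofLp = B *ᵥ u) (hr : 1 < r) (hur : u ⬝ᵥ u = r ^ 2) :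
    Rounding (insert z Z) (c + (shift α r / r) • (z - c))
      (B * stretchMatrix r (widen α r) u) (unstretchMatrix r (widen α r) u * G) (shrink α r) := by
  have hm : m ≠ 0 := by
    rintro rfl
    simp at hur
    nlinarith
  have hα := h.pos
  have hα' := h.le_twelfth hm
  have hb := one_lt_widen hα hr
  have hinv := unstretch_mul_stretch (m := m) (by linarith : 0 < r)
    (by linarith : 0 < widen α r) hur
  have hinv' := mul_eq_one_comm.1 hinv
  set b := widen α r
  set S := stretchMatrix r b u with hS
  have hr0 : r ≠ 0 := by linarith
  set w : EuclideanSpace ℝ (Fin m) := WithLp.toLp 2 ((1 / r) • u) with hwdef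
  have hw : ‖w‖ = 1 := by
    have : ‖w‖ ^ 2 = 1 := by
      rw [← dotProduct_self_eq_norm_sq, hwdef]
      simp only [dotProduct_smul, smul_dotProduct, hur, smul_eq_mul]
      field_simp
    nlinarith [norm_nonneg w]
  have hSx : ∀ x : EuclideanSpace ℝ (Fin m),
      toEuclideanLin (B * S) x = toEuclideanLin B (stretch r b w x) := by
    intro x
    rw [toEuclideanLin_eq, toEuclideanLin_eq, ← mulVec_mulVec]
    congr 2
    rw [hS, stretchMatrix, add_mulVec, smul_mulVec, one_mulVec, smul_mulVec, vecMulVec_mulVec]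
    have : inner ℝ w x = (1 / r) * (u ⬝ᵥ x.ofLp) := by
      rw [EuclideanSpace.inner_eq_star_dotProduct, hwdef]
      simp [dotProduct_comm]
    have hwi : ∀ i, w.ofLp i = u i / r := fun i => by rw [hwdef]; simp; field_simp
    ext i
    simp [stretch, this, hwi]
    field_simp
  have htip : z = c + toEuclideanLin B (r • w) := by
    rw [toEuclideanLin_eq]
    have : (r • w).ofLp = u := by rw [hwdef]; ext i; simp; field_simp
    rw [this, ← hu]; simp
  have hc : c + (shift α r / r) • (z - c) = c + toEuclideanLin B (shift α r • w) := by
    have : z - c = r • toEuclideanLin B w := by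
      rw [← map_smul, sub_eq_iff_eq_add, add_comm]; exact htip
    rw [this, smul_smul, div_mul_cancel₀ _ hr0, map_smul]
  rw [hc]
  exact
  { nonempty := Set.insert_nonempty z Z
    left_inv := by
      rw [Matrix.mul_assoc, ← Matrix.mul_assoc G, h.left_inv, Matrix.one_mul, hinv]
    normal := by
      rw [Matrix.mul_assoc B, ← Matrix.mul_assoc S, hinv', Matrix.one_mul, transpose_mul,
        Matrix.mul_assoc, h.normal]
    pos := shrink_pos hα hr
    le_one := (shrink_le hα hr).trans h.le_one
    eq_one := fun h0 => absurd h0 hm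
    le_twelfth := fun _ => (shrink_le hα hr).trans hα'
    inner_mem := fun x hx => by
      rw [hSx]
      refine mem_of_stretch (convex_convexHull ℝ _) (toEuclideanLin B) hw hα hα' hr ?_ ?_ hx
      · exact fun y hy => convexHull_mono (Set.subset_insert z Z) (h.inner_mem y hy)
      · rw [← htip]; exact subset_convexHull ℝ _ (Set.mem_insert z Z)
    outer_mem := fun y hy => by
      rcases hy with rfl | hy
      · obtain ⟨v, hv, e⟩ := exists_shift_add_stretch_tip hw hα hα' hr
        exact ⟨v, hv, by rw [hSx, add_assoc, ← map_add, ← e]; exact htip⟩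
      · obtain ⟨x, hx, rfl⟩ := h.outer_mem y hy
        obtain ⟨v, hv, e⟩ := exists_shift_add_stretch hw hα hα' hr hx
        exact ⟨v, hv, by rw [hSx, add_assoc, ← map_add, ← e]⟩
    det_bound := by
      obtain ⟨Y, T, hB, hT, hα2⟩ := h.det_bound
      have hdet := det_stretchMatrix (m := m) (by linarith : 0 < r) (by linarith : 0 < b) hur
      -- As m ≥ 1, the determinant is r times a power of b > 1. With 1 - 1/r ≤ log r the potential
      -- pays for the growth of 1/α.
      have hdet' : r ≤ S.det := by
        obtain ⟨k, rfl⟩ := Nat.exists_eq_succ_of_ne_zero hm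
        rw [hS, hdet, pow_succ, mul_assoc, mul_div_cancel₀ _ (by linarith : b ≠ 0)]
        exact le_mul_of_one_le_left (by linarith) (one_le_pow₀ hb.le)
      have hlog : 1 - 1 / r ≤ Real.log S.det := by
        rw [one_div]
        exact (Real.one_sub_inv_le_log_of_pos (by linarith)).trans
          (Real.log_le_log (by linarith) hdet')
      have hS0 : 0 < S.det := by linarith
      refine ⟨Y, T * S, by rw [hB, Matrix.mul_assoc], by rw [det_mul]; positivity, ?_⟩
      rw [det_mul, Real.log_mul hT.ne' hS0.ne', one_div_shrink hα]
      linarith }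

theorem normal_mulVec (h : Rounding Z c B G α) (y : Fin d → ℝ) :
    (y - B *ᵥ (G *ᵥ y)) ᵥ* B = 0 := by
  rw [← mulVec_transpose, mulVec_sub, mulVec_mulVec, mulVec_mulVec, Matrix.mul_assoc,
    h.normal, sub_self]

/-- The residual v is orthogonal to the columns of B and satisfies v·y = s. So v/s reads off the
coefficient of y, and subtracting g times it from G removes the contribution of y to the old
coordinates. -/
theorem left_inv_append (h : Rounding Z c B G α) {y v : Fin d → ℝ} {g : Fin m → ℝ}
    {b s : ℝ} (hb : b ≠ 0) (hg : g = G *ᵥ y) (hv : v = y - B *ᵥ g) (hs : s = v ⬝ᵥ v)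
    (hs0 : s ≠ 0) :
    appendRow (Matrix.of fun i j => (G i j - g i * v j / s) / b) ((1 / s) • v) *
      appendCol (b • B) y = 1 := by
  have hvB : v ᵥ* B = 0 := by rw [hv, hg]; exact h.normal_mulVec y
  have hvB' : ∀ j, ∑ k, v k * B k j = 0 := fun j => congrFun hvB j
  have hvy : ∑ k, v k * y k = s := by
    have : y = v + B *ᵥ g := by rw [hv]; simp
    have e : v ⬝ᵥ y = s := by
      conv_lhs => rw [this, dotProduct_add, dotProduct_mulVec, hvB, zero_dotProduct, add_zero]
      exact hs.symm
    exact e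
  have hGB : ∀ i j, ∑ k, G i k * B k j = (1 : Matrix (Fin m) (Fin m) ℝ) i j := fun i j => by
    rw [← h.left_inv]; rfl
  have hGy : ∀ i, ∑ k, G i k * y k = g i := fun i => by rw [hg]; rfl
  have e1 : ∀ (i : Fin m) (q : Fin d → ℝ), ∑ k, (G i k - g i * v k / s) / b * q k =
      (∑ k, G i k * q k - g i / s * ∑ k, v k * q k) / b := by
    intro i q
    rw [Finset.mul_sum, ← Finset.sum_sub_distrib, Finset.sum_div]
    exact Finset.sum_congr rfl fun k _ => by ring
  have e2 : ∀ q : Fin d → ℝ, ∑ k, (1 / s) * v k * q k = (1 / s) * ∑ k, v k * q k := by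
    intro q
    rw [Finset.mul_sum]
    exact Finset.sum_congr rfl fun k _ => by ring
  have e3 : ∀ (q : Fin d → ℝ) (j : Fin m), ∑ k, q k * (b * B k j) = b * ∑ k, q k * B k j := by
    intro q j
    rw [Finset.mul_sum]
    exact Finset.sum_congr rfl fun k _ => by ring
  ext i j
  rw [Matrix.mul_apply]
  refine Fin.lastCases ?_ (fun i => ?_) i <;> refine Fin.lastCases ?_ (fun j => ?_) j
  · simp only [appendRow_last, appendCol_last, Pi.smul_apply, smul_eq_mul, e2, hvy, one_apply_eq]
    field_simp
  · simp only [appendRow_last, appendCol_castSucc, Pi.smul_apply, Matrix.smul_apply, smul_eq_mul, e2, e3,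
      hvB', mul_zero]
    rw [one_apply_ne (Fin.castSucc_lt_last j).ne']
  · simp only [appendRow_castSucc, appendCol_last, of_apply, e1, hGy, hvy]
    rw [one_apply_ne (Fin.castSucc_lt_last i).ne]
    field_simp
    ring
  · simp only [appendRow_castSucc, appendCol_castSucc, of_apply, Matrix.smul_apply, smul_eq_mul, e1,
      hGB, hvB', e3, mul_zero, sub_zero]
    rw [mul_div_cancel_left₀ _ hb]
    simp [one_apply]

/-- The new product is BG + vvᵀ/s, the orthogonal projection onto the span of the old columns and v.
It fixes every old column as well as y = v + Bg. -/
theorem normal_append (h : Rounding Z c B G α) {y v : Fin d → ℝ} {g : Fin m → ℝ}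
    {b s : ℝ} (hb : b ≠ 0) (hg : g = G *ᵥ y) (hv : v = y - B *ᵥ g) (hs : s = v ⬝ᵥ v)
    (hs0 : s ≠ 0) :
    (appendCol (b • B) y)ᵀ * (appendCol (b • B) y *
      appendRow (Matrix.of fun i j => (G i j - g i * v j / s) / b) ((1 / s) • v)) =
      (appendCol (b • B) y)ᵀ := by
  have hvB : v ᵥ* B = 0 := by rw [hv, hg]; exact h.normal_mulVec y
  have hP : appendCol (b • B) y *
      appendRow (Matrix.of fun i j => (G i j - g i * v j / s) / b) ((1 / s) • v) =
      B * G + (1 / s) • vecMulVec v v := by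
    ext i j
    have hvi : y i = v i + ∑ k, B i k * g k := by
      have : y i = v i + (B *ᵥ g) i := by rw [hv]; simp
      exact this
    rw [Matrix.mul_apply, Fin.sum_univ_castSucc]
    simp only [appendRow_last, appendCol_last, appendRow_castSucc, appendCol_castSucc, of_apply,
      Matrix.smul_apply, smul_eq_mul, Pi.smul_apply, Matrix.add_apply, Matrix.mul_apply, vecMulVec_apply, hvi]
    have : ∀ k, b * B i k * ((G k j - g k * v j / s) / b) =
        B i k * G k j - (v j / s) * (B i k * g k) := fun k => by field_simp
    simp only [this]
    rw [Finset.sum_sub_distrib, ← Finset.mul_sum]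
    ring
  have hrow : ∀ q : Fin d → ℝ, q ᵥ* (B * G) + ((1 / s) * (q ⬝ᵥ v)) • v = q →
      q ᵥ* (B * G + (1 / s) • vecMulVec v v) = q := by
    intro q hq
    rw [vecMul_add, vecMul_smul, vecMul_vecMulVec, smul_smul]
    exact hq
  rw [hP]
  ext i j
  have key : ∀ q : Fin d → ℝ, (appendCol (b • B) y)ᵀ i = q →
      q ᵥ* (B * G) + ((1 / s) * (q ⬝ᵥ v)) • v = q →
      ((appendCol (b • B) y)ᵀ * (B * G + (1 / s) • vecMulVec v v)) i j =
      (appendCol (b • B) y)ᵀ i j := by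
    rintro q rfl hq
    exact congrFun (hrow _ hq) j
  refine Fin.lastCases (motive := fun i => (∀ q : Fin d → ℝ, (appendCol (b • B) y)ᵀ i = q →
      q ᵥ* (B * G) + ((1 / s) * (q ⬝ᵥ v)) • v = q →
      ((appendCol (b • B) y)ᵀ * (B * G + (1 / s) • vecMulVec v v)) i j =
      (appendCol (b • B) y)ᵀ i j) → ((appendCol (b • B) y)ᵀ *
      (B * G + (1 / s) • vecMulVec v v)) i j = (appendCol (b • B) y)ᵀ i j) ?_ (fun k => ?_) i key
  · intro key
    refine key y (by ext k; simp [transpose_apply]) ?_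
    have e : y = v + B *ᵥ g := by rw [hv]; simp
    have hBG : (B *ᵥ g) ᵥ* (B * G) = B *ᵥ g := by
      have : (B *ᵥ g) = g ᵥ* Bᵀ := (vecMul_transpose B g).symm
      rw [this, vecMul_vecMul, h.normal]
    have hyv : y ⬝ᵥ v = s := by
      rw [dotProduct_comm, e, dotProduct_add, dotProduct_mulVec, hvB, zero_dotProduct, add_zero, hs]
    rw [hyv, one_div_mul_cancel hs0, one_smul]
    conv_lhs => rw [e, add_vecMul, ← vecMul_vecMul, hvB, zero_vecMul, zero_add, hBG]
    rw [e]; abel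
  · intro key
    refine key (b • Bᵀ k) (by ext l; simp [transpose_apply]) ?_
    have h1 : Bᵀ k ᵥ* (B * G) = Bᵀ k := congrFun h.normal k
    have h2 : Bᵀ k ⬝ᵥ v = 0 := by
      rw [dotProduct_comm]; exact congrFun hvB k
    rw [smul_vecMul, h1, smul_dotProduct, h2]
    simp

theorem insert_append (h : Rounding Z c B G α) {z : EuclideanSpace ℝ (Fin d)}
    (hZ : ∀ z' ∈ insert z Z, ∃ k : Fin d → ℤ, ∀ i, z'.ofLp i = k i)
    {v : Fin d → ℝ} {g : Fin m → ℝ} {s : ℝ} (hg : g = G *ᵥ (z - c).ofLp)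
    (hv : v = (z - c).ofLp - B *ᵥ g) (hs : s = v ⬝ᵥ v) (hs0 : s ≠ 0) :
    Rounding (insert z Z) (c + (α / (1 + 12 * α)) • (z - c))
      (appendCol ((1 + α) • B) (z - c).ofLp)
      (appendRow (Matrix.of fun i j => (G i j - g i * v j / s) / (1 + α)) ((1 / s) • v))
      (α / (1 + 12 * α)) := by
  have hα := h.pos
  have hα' := h.le_one
  have hb : (1 + α) ≠ 0 := by positivity
  have hL : ∀ x : EuclideanSpace ℝ (Fin (m + 1)),
      toEuclideanLin (appendCol ((1 + α) • B) (z - c).ofLp) x =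
      toEuclideanLin B ((1 + α) • WithLp.toLp 2 fun j => x.ofLp j.castSucc) +
        x.ofLp (Fin.last m) • (z - c) := by
    intro x
    rw [toEuclideanLin_eq, toEuclideanLin_eq, appendCol_mulVec, smul_mulVec]
    ext i
    simp [mulVec_smul]
  have hnorm : ∀ x : EuclideanSpace ℝ (Fin (m + 1)), ‖x‖ ^ 2 =
      ‖(WithLp.toLp 2 fun j => x.ofLp j.castSucc : EuclideanSpace ℝ (Fin m))‖ ^ 2 +
        x.ofLp (Fin.last m) ^ 2 := by
    intro x
    rw [EuclideanSpace.norm_sq_eq, EuclideanSpace.norm_sq_eq, Fin.sum_univ_castSucc]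
    simp
  have hbuild : ∀ (x : EuclideanSpace ℝ (Fin m)) (ξ : ℝ), ‖x‖ ^ 2 + ξ ^ 2 ≤ 1 →
      ∃ x' : EuclideanSpace ℝ (Fin (m + 1)), ‖x'‖ ≤ 1 ∧
        toEuclideanLin (appendCol ((1 + α) • B) (z - c).ofLp) x' =
        toEuclideanLin B ((1 + α) • x) + ξ • (z - c) := by
    intro x ξ hx
    refine ⟨WithLp.toLp 2 (Fin.snoc (α := fun _ => ℝ) x.ofLp ξ), ?_, ?_⟩
    · rw [← sq_le_one_iff₀ (norm_nonneg _), hnorm]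
      simpa using hx
    · rw [hL]; simp
  have hle : α / (1 + 12 * α) ≤ 1 / 12 := by rw [div_le_iff₀ (by positivity)]; linarith
  exact
  { nonempty := Set.insert_nonempty z Z
    left_inv := h.left_inv_append hb hg hv hs hs0
    normal := h.normal_append hb hg hv hs hs0
    pos := by positivity
    le_one := hle.trans (by norm_num)
    eq_one := fun h0 => absurd h0 (Nat.succ_ne_zero m)
    le_twelfth := fun _ => hle
    inner_mem := fun x hx => by
      rw [hL]
      refine mem_of_cone (convex_convexHull ℝ _) (toEuclideanLin B) hα ?_ ?_ ?_
      · exact fun y hy => convexHull_mono (Set.subset_insert z Z) (h.inner_mem y hy)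
      · rw [add_sub_cancel]; exact subset_convexHull ℝ _ (Set.mem_insert z Z)
      · rw [← hnorm]; nlinarith [norm_nonneg x]
    outer_mem := fun y hy => by
      rcases hy with rfl | hy
      · obtain ⟨x, hx, e⟩ := hbuild 0 (1 - α / (1 + 12 * α)) (by
          have : 0 < α / (1 + 12 * α) := by positivity
          rw [norm_zero]; nlinarith)
        refine ⟨x, hx, ?_⟩
        rw [e, smul_zero, map_zero, zero_add, add_assoc, ← add_smul, add_sub_cancel, one_smul,
          add_sub_cancel]
      · obtain ⟨x, hx, rfl⟩ := h.outer_mem y hy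
        obtain ⟨x', ξ, h1, h2, h3⟩ := exists_cone_base hα hα' hx
        obtain ⟨x'', hx'', e⟩ := hbuild x' ξ h1
        refine ⟨x'', hx'', ?_⟩
        rw [e, ← h2, add_assoc, add_left_comm (_ • (z - c)), ← add_smul, ← h3, zero_smul, add_zero]
    det_bound := by
      obtain ⟨Y, T, hB, hT, hα2⟩ := h.det_bound
      obtain ⟨z₁, hz₁⟩ := h.nonempty
      obtain ⟨k₁, hk₁⟩ := hZ z₁ (Set.mem_insert_of_mem z hz₁)
      obtain ⟨k, hk⟩ := hZ z (Set.mem_insert z Z)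
      obtain ⟨x₀, -, hx₀⟩ := h.outer_mem z₁ hz₁
      set p : Fin m → ℝ := T *ᵥ x₀.ofLp with hp
      -- The center need not be integral, but an old point z₁ = c + Bx₀ is. Thus z - c is the
      -- integer vector z - z₁ plus a combination Yp of the old integer columns.
      have hy : ∀ i, (z - c).ofLp i = ∑ j, (Y i j : ℝ) * p j + ((k i : ℝ) - k₁ i) := by
        intro i
        have h1 : z₁.ofLp i = c.ofLp i + ∑ j, (Y i j : ℝ) * p j := by
          conv_lhs => rw [hx₀, toEuclideanLin_eq, hB, ← mulVec_mulVec]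
          rfl
        rw [PiLp.sub_apply, hk]
        rw [hk₁] at h1
        linarith
      -- T' is block upper triangular with diagonal blocks (1 + α)T and 1, so its determinant is at
      -- least that of T.
      let T' : Matrix (Fin (m + 1)) (Fin (m + 1)) ℝ :=
        appendRow (appendCol ((1 + α) • T) p) (Fin.snoc (α := fun _ => ℝ) 0 1)
      have hdet : T'.det = (1 + α) ^ m * T.det := by
        rw [det_succ_row T' (Fin.last m), Fin.sum_univ_castSucc]
        have hsub : T'.submatrix (Fin.last m).succAbove (Fin.last m).succAbove = (1 + α) • T := by
          ext i j
          simp [T', Fin.succAbove_last]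
        rw [hsub]
        simp [T', ← two_mul, pow_mul]
      have hpow : 1 ≤ (1 + α) ^ m := one_le_pow₀ (by linarith)
      have hT' : T.det ≤ T'.det := by rw [hdet]; exact le_mul_of_one_le_left hT.le hpow
      refine ⟨appendCol Y (fun i => k i - k₁ i), T', ?_, by linarith, ?_⟩
      · ext i j
        rw [Matrix.mul_apply, Fin.sum_univ_castSucc]
        refine Fin.lastCases ?_ (fun j => ?_) j
        · rw [appendCol_last, hy]; simp [T']
        · simp only [appendCol_castSucc, Matrix.smul_apply, smul_eq_mul, T', map_apply, appendRow_castSucc,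
            appendRow_last, Fin.snoc_castSucc, Pi.zero_apply, mul_zero, add_zero]
          rw [hB, Matrix.mul_apply, Finset.mul_sum]
          exact Finset.sum_congr rfl fun k _ => by simp; ring
      · have hlog := Real.log_le_log hT hT'
        have e : 1 / (α / (1 + 12 * α)) = 1 / α + 12 := by field_simp
        rw [e]
        push_cast
        linarith }

/-! ### The bound on the approximation factor and the dimension. -/

theorem mulVec_injective (h : Rounding Z c B G α) : Function.Injective B.mulVec := by
  intro x y hxy
  have := congrArg (G *ᵥ ·) hxy
  simpa [h.left_inv] using this

theorem toEuclideanLin_injective (h : Rounding Z c B G α) :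
    Function.Injective (toEuclideanLin B) := by
  intro x y hxy
  have : B *ᵥ x.ofLp = B *ᵥ y.ofLp := congrArg WithLp.ofLp hxy
  ext i
  exact congrFun (h.mulVec_injective this) i

theorem rank_le (h : Rounding Z c B G α) : m ≤ d := by
  simpa using LinearMap.finrank_le_finrank_of_injective h.toEuclideanLin_injective

/-- The points c ± αBe_j both lie in the convex hull, hence in the box of radius N; their difference
is 2αBe_j. -/
theorem abs_mul_apply_le (h : Rounding Z c B G α) {N : ℝ}
    (hN : ∀ z ∈ Z, ∀ i, |z.ofLp i| ≤ N) (i : Fin d) (j : Fin m) : |B i j| ≤ N * (1 / α) := by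
  have hα := h.pos
  have hconv : convexHull ℝ Z ⊆ {x | |x.ofLp i| ≤ N} := by
    have : {x : EuclideanSpace ℝ (Fin d) | |x.ofLp i| ≤ N} =
        (EuclideanSpace.proj i : EuclideanSpace ℝ (Fin d) →L[ℝ] ℝ) ⁻¹' Set.Icc (-N) N := by
      ext x; simp [abs_le]
    refine convexHull_min (fun z hz => hN z hz i) ?_
    rw [this]
    exact (convex_Icc (-N) N).linear_preimage (EuclideanSpace.proj i : _ →L[ℝ] ℝ).toLinearMap
  have hL : (toEuclideanLin B (EuclideanSpace.single j 1)).ofLp i = B i j := by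
    rw [toEuclideanLin_eq]; simp
  have h1 := hconv (h.inner_mem (EuclideanSpace.single j 1) (by simp))
  have h2 := hconv (h.inner_mem (-EuclideanSpace.single j 1) (by simp))
  simp only [Set.mem_ofPred_eq, map_neg, PiLp.add_apply, PiLp.smul_apply, PiLp.neg_apply, hL,
    smul_eq_mul] at h1 h2
  rw [mul_one_div, le_div_iff₀ hα]
  rw [abs_le] at h1 h2
  rw [← abs_of_pos hα, ← abs_mul, abs_le]
  constructor <;> linarith

/-- Integrality enters here: det(YᵀY) is an integer, positive because B is injective, hence at least
1. The Gram determinant of B is then estimated by the Leibniz formula with m! ≤ m^m. -/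
theorem det_sq_le {N : ℝ} (h : Rounding Z c B G α) (hN : ∀ z ∈ Z, ∀ i, |z.ofLp i| ≤ N)
    {Y : Matrix (Fin d) (Fin m) ℤ} {T : Matrix (Fin m) (Fin m) ℝ}
    (hB : B = Y.map (fun k : ℤ => (k : ℝ)) * T) :
    T.det ^ 2 ≤ (m * (d * (N * (1 / α)) ^ 2)) ^ m := by
  have hα := h.pos
  set Y' : Matrix (Fin d) (Fin m) ℝ := Y.map (fun k : ℤ => (k : ℝ)) with hY'
  have hgram : (Bᵀ * B).det = T.det ^ 2 * (Y'ᵀ * Y').det := by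
    rw [hB, transpose_mul, Matrix.mul_assoc, ← Matrix.mul_assoc Y'ᵀ, det_mul, det_mul,
      det_transpose]
    ring
  have hpos : 0 < (Bᵀ * B).det := by
    have := (PosDef.conjTranspose_mul_self B h.mulVec_injective).det_pos
    rwa [conjTranspose_eq_transpose_of_trivial] at this
  have hint : (Y'ᵀ * Y').det = (((Yᵀ * Y).det : ℤ) : ℝ) := by
    have : Y'ᵀ * Y' = (Int.castRingHom ℝ).mapMatrix (Yᵀ * Y) := by
      rw [hY']
      ext i j
      simp [Matrix.mul_apply]
    rw [this, ← RingHom.map_det]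
    rfl
  have hYpos : 0 < (Y'ᵀ * Y').det := by
    rw [hgram] at hpos
    exact pos_of_mul_pos_right hpos (sq_nonneg _)
  have hY1 : 1 ≤ (Y'ᵀ * Y').det := by
    rw [hint] at hYpos ⊢
    exact_mod_cast hYpos
  have hentry : ∀ i j, AbsoluteValue.abs ((Bᵀ * B) i j) ≤ d * (N * (1 / α)) ^ 2 := by
    intro i j
    rw [Matrix.mul_apply]
    calc |∑ k, Bᵀ i k * B k j| ≤ ∑ k : Fin d, |Bᵀ i k * B k j| := Finset.abs_sum_le_sum_abs _ _
      _ ≤ ∑ _k : Fin d, (N * (1 / α)) ^ 2 := by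
        refine Finset.sum_le_sum fun k _ => ?_
        rw [abs_mul, sq, transpose_apply]
        have h1 := h.abs_mul_apply_le hN k i
        have h2 := h.abs_mul_apply_le hN k j
        exact mul_le_mul h1 h2 (abs_nonneg _) ((abs_nonneg _).trans h1)
      _ = d * (N * (1 / α)) ^ 2 := by simp
  have hdet : |(Bᵀ * B).det| ≤ m.factorial * (d * (N * (1 / α)) ^ 2) ^ m := by
    simpa using det_le (abv := AbsoluteValue.abs) hentry
  calc T.det ^ 2 ≤ T.det ^ 2 * (Y'ᵀ * Y').det := le_mul_of_one_le_right (sq_nonneg _) hY1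
    _ = (Bᵀ * B).det := hgram.symm
    _ ≤ _ := (le_abs_self _).trans hdet
    _ ≤ (m : ℝ) ^ m * (d * (N * (1 / α)) ^ 2) ^ m := by
      gcongr
      exact_mod_cast Nat.factorial_le_pow m
    _ = _ := (mul_pow _ _ _).symm

theorem one_div_le (h : Rounding Z c B G α) {N : ℕ} (hN : ∀ z ∈ Z, ∀ i, |z.ofLp i| ≤ N)
    (hdN : 2 ≤ d * N) (hm : 1 ≤ m) :
    1 / α ≤ 80 * (m * Real.log ((d : ℝ) * (N : ℝ))) := by
  obtain ⟨Y, T, hB, hT, hα⟩ := h.det_bound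
  have hα0 := h.pos
  have hsq := h.det_sq_le hN hB
  have hmd := h.rank_le
  have hD : 0 < 1 / α := by positivity
  generalize 1 / α = D at *
  have hN1 : 1 ≤ N := Nat.pos_of_ne_zero (by rintro rfl; simp at hdN)
  have hd1 : 1 ≤ d := hm.trans hmd
  have hm0 : (0 : ℝ) < m := by exact_mod_cast hm
  have hN0 : (0 : ℝ) < N := by exact_mod_cast hN1
  have hd0 : (0 : ℝ) < d := by exact_mod_cast hd1
  have hm1 : (1 : ℝ) ≤ m := by exact_mod_cast hm
  have hmd' : (m : ℝ) ≤ d := by exact_mod_cast hmd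
  have hN1' : (1 : ℝ) ≤ N := by exact_mod_cast hN1
  set Λ := Real.log ((d : ℝ) * N) with hΛ
  have hΛ2 : 0.69 ≤ Λ := by
    have h1 : Real.log 2 ≤ Λ := Real.log_le_log two_pos (by exact_mod_cast hdN)
    linarith [Real.log_two_gt_d9]
  have hmΛ : Real.log m ≤ Λ := Real.log_le_log hm0 (by nlinarith)
  have hlogT : Real.log T.det ≤ m * (Λ + Real.log D) := by
    have h1 : (m : ℝ) * (d * (N * D) ^ 2) ≤ (d * N * D) ^ 2 := by
      have : (d * N * D) ^ 2 = (d : ℝ) * (d * (N * D) ^ 2) := by ring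
      rw [this]; gcongr
    have h2 : T.det ^ 2 ≤ ((d * N * D) ^ 2) ^ m :=
      hsq.trans (pow_le_pow_left₀ (by positivity) h1 m)
    have h3 := Real.log_le_log (by positivity) h2
    rw [Real.log_pow, Real.log_pow, Real.log_pow, Real.log_mul (by positivity) hD.ne', ← hΛ] at h3
    push_cast at h3
    linarith
  -- The tangent bound log t ≤ t - 1 at t = D/(8m): after multiplication by 4m the term linear in D
  -- is D/2, which the left side absorbs.
  have hlogD : Real.log D ≤ D / (8 * m) - 1 + 3 * Real.log 2 + Λ := by
    have h1 : D = D / (8 * m) * (2 ^ 3 * m) := by field_simp; norm_num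
    have h2 : Real.log D = Real.log (D / (8 * m)) + (3 * Real.log 2 + Real.log m) := by
      conv_lhs => rw [h1]
      rw [Real.log_mul (by positivity) (by positivity), Real.log_mul (by positivity) hm0.ne',
        Real.log_pow]
      push_cast; ring
    have h3 := Real.log_le_sub_one_of_pos (show 0 < D / (8 * m) by positivity)
    linarith
  have h1 : (m : ℝ) * (Λ + Real.log D) ≤
      m * (Λ + (D / (8 * m) - 1 + 3 * Real.log 2 + Λ)) := by gcongr
  have h2 : (m : ℝ) * (Λ + (D / (8 * m) - 1 + 3 * Real.log 2 + Λ)) =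
      D / 8 + m * (2 * Λ + 3 * Real.log 2 - 1) := by field_simp; ring
  have h3 : (m : ℝ) * (2 * Λ + 3 * Real.log 2 - 1) ≤ m * (2 * Λ + 1.1) := by
    gcongr; linarith [Real.log_two_lt_d9]
  have h4 : (m : ℝ) * 0.69 ≤ m * Λ := by gcongr
  nlinarith

theorem finrank_direction (h : Rounding Z c B G α) :
    Module.finrank ℝ (affineSpan ℝ Z).direction = m := by
  have hα := h.pos
  have hc : c ∈ affineSpan ℝ Z := by
    have := h.inner_mem 0 (by simp)
    exact convexHull_subset_affineSpan Z (by simpa using this)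
  have hdir : (affineSpan ℝ Z).direction = LinearMap.range (toEuclideanLin B) := by
    apply le_antisymm
    · have hsub : affineSpan ℝ Z ≤ AffineSubspace.mk' c (LinearMap.range (toEuclideanLin B)) := by
        rw [affineSpan_le]
        intro z hz
        obtain ⟨x, -, rfl⟩ := h.outer_mem z hz
        simp [AffineSubspace.mem_mk']
      have := AffineSubspace.direction_le hsub
      rwa [AffineSubspace.direction_mk'] at this
    · rintro _ ⟨x, rfl⟩
      -- Scaling x into the unit ball makes the inner inclusion applicable; the factor is undone
      -- inside the direction.
      have hx : 0 < 1 + ‖x‖ := by positivity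
      have h1 := convexHull_subset_affineSpan Z (h.inner_mem ((1 + ‖x‖)⁻¹ • x) (by
        rw [norm_smul, norm_inv, Real.norm_of_nonneg hx.le, inv_mul_le_one₀ hx]; linarith))
      have h2 := AffineSubspace.vsub_mem_direction h1 hc
      rw [vsub_eq_sub, add_sub_cancel_left, map_smul, smul_smul] at h2
      have h3 := Submodule.smul_mem _ (α * (1 + ‖x‖)⁻¹)⁻¹ h2
      rwa [smul_smul, inv_mul_cancel₀ (by positivity), one_smul] at h3
  rw [hdir, LinearMap.finrank_range_of_inj h.toEuclideanLin_injective]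
  simp

end Rounding

end EllipsoidUpdate

/-! ### Memory layout. -/

namespace RealRAM

/-- The memory seen as a collection of blocks with `d + 1` entries each and of `d × d` matrices. -/
structure Store where
  blk : ℕ → ℕ → ℝ
  mat : ℕ → ℕ → ℕ → ℝ

namespace Store

def setBlk (M : Store) (k i : ℕ) (x : ℝ) : Store where
  blk k' i' := if k' = k ∧ i' = i then x else M.blk k' i'
  mat := M.mat

/-- Overwrite the first `n` entries of block `k`. -/
def setVec (M : Store) (k n : ℕ) (f : ℕ → ℝ) : Store where
  blk k' i' := if k' = k ∧ i' < n then f i' else M.blk k' i'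
  mat := M.mat

def setEntry (M : Store) (k i j : ℕ) (x : ℝ) : Store where
  blk := M.blk
  mat k' i' j' := if k' = k ∧ i' = i ∧ j' = j then x else M.mat k' i' j'

/-- Overwrite the first `n` entries of row `i` of matrix `k`. -/
def setRow (M : Store) (k i n : ℕ) (f : ℕ → ℝ) : Store where
  blk := M.blk
  mat k' i' j' := if k' = k ∧ i' = i ∧ j' < n then f j' else M.mat k' i' j'

/-- Overwrite the first `n` entries of column `j` of matrix `k`. -/
def setCol (M : Store) (k j n : ℕ) (f : ℕ → ℝ) : Store where
  blk := M.blk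
  mat k' i' j' := if k' = k ∧ i' < n ∧ j' = j then f i' else M.mat k' i' j'

/-- Overwrite the first `n` rows of matrix `k`. -/
def setMat (M : Store) (k n : ℕ) (f : ℕ → ℕ → ℝ) : Store where
  blk := M.blk
  mat k' i' j' := if k' = k ∧ i' < n then f i' j' else M.mat k' i' j'

end Store

/-- The blocks with number at least `2` lie behind the two matrices. -/
def blkOffset (k : ℕ) : ℕ := if k < 2 then 0 else 2

def blkAddr (d k i : ℕ) : ℕ := blkOffset k * (d * d) + k * (d + 1) + i

/-- Matrix 0 starts where `StreamAlgorithm.shape` reads; matrix 1 follows and holds G. -/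
def matAddr (d k i j : ℕ) : ℕ := 2 * d + 1 + k * (d * d) + (i * d + j)

/-- Block 1 has no entry d: its address 2d + 1 is the first cell of matrix 0. -/
def BlkValid (d k i : ℕ) : Prop := k < 8 ∧ i ≤ d ∧ (k = 1 → i < d)

def MatValid (d k i j : ℕ) : Prop := k < 2 ∧ i < d ∧ j < d

theorem mul_add_lt {d i j : ℕ} (hi : i < d) (hj : j < d) : i * d + j < d * d := by
  nlinarith [Nat.mul_le_mul_right d (Nat.succ_le_of_lt hi)]

theorem mul_add_inj {d i j i' j' : ℕ} (hj : j < d) (hj' : j' < d)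
    (h : i * d + j = i' * d + j') : i = i' ∧ j = j' := by
  have h1 : (i * d + j) / d = i := by
    rw [mul_comm, Nat.mul_add_div (by omega), Nat.div_eq_of_lt hj, add_zero]
  have h2 : (i' * d + j') / d = i' := by
    rw [mul_comm, Nat.mul_add_div (by omega), Nat.div_eq_of_lt hj', add_zero]
  have : i = i' := by rw [← h1, h, h2]
  subst this
  exact ⟨rfl, by omega⟩

theorem blkAddr_inj {d k i k' i' : ℕ} (h : BlkValid d k i) (h' : BlkValid d k' i')
    (e : blkAddr d k i = blkAddr d k' i') : k = k' ∧ i = i' := by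
  obtain ⟨h1, h2, h3⟩ := h
  obtain ⟨h1', h2', h3'⟩ := h'
  unfold blkAddr blkOffset at e
  generalize d * d = D at e
  interval_cases k <;> interval_cases k' <;> simp at e h3 h3' ⊢ <;> omega

theorem matAddr_inj {d k i j k' i' j' : ℕ} (h : MatValid d k i j) (h' : MatValid d k' i' j')
    (e : matAddr d k i j = matAddr d k' i' j') : k = k' ∧ i = i' ∧ j = j' := by
  obtain ⟨h1, h2, h3⟩ := h
  obtain ⟨h1', h2', h3'⟩ := h'
  have l := mul_add_lt h2 h3
  have l' := mul_add_lt h2' h3'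
  unfold matAddr at e
  have : k = k' := by
    generalize d * d = D at *
    interval_cases k <;> interval_cases k' <;> omega
  subst this
  exact ⟨rfl, mul_add_inj h3 h3' (by omega)⟩

theorem blkAddr_ne_matAddr {d k i k' i' j' : ℕ} (h : BlkValid d k i) (h' : MatValid d k' i' j') :
    blkAddr d k i ≠ matAddr d k' i' j' := by
  obtain ⟨h1, h2, h3⟩ := h
  obtain ⟨h1', h2', h3'⟩ := h'
  have l' := mul_add_lt h2' h3'
  unfold blkAddr matAddr blkOffset
  generalize d * d = D at *
  interval_cases k <;> interval_cases k' <;> simp at h3 ⊢ <;> omega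

/-- The memory of `σ` holds the entries of `M`. -/
structure Rep (d : ℕ) (σ : State) (M : Store) : Prop where
  blk : ∀ k i, BlkValid d k i → σ.mem (blkAddr d k i) = M.blk k i
  mat : ∀ k i j, MatValid d k i j → σ.mem (matAddr d k i j) = M.mat k i j

theorem Rep.congr {d : ℕ} {σ : State} {M M' : Store} (h : Rep d σ M)
    (hb : ∀ k i, BlkValid d k i → M.blk k i = M'.blk k i)
    (hm : ∀ k i j, MatValid d k i j → M.mat k i j = M'.mat k i j) : Rep d σ M' :=
  ⟨fun k i hv => (h.blk k i hv).trans (hb k i hv),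
    fun k i j hv => (h.mat k i j hv).trans (hm k i j hv)⟩

theorem Rep.setBlk {d : ℕ} {σ : State} {M : Store} (h : Rep d σ M) {k i : ℕ}
    (hv : BlkValid d k i) (x : ℝ) :
    Rep d ⟨σ.reg, Function.update σ.mem (blkAddr d k i) x⟩ (M.setBlk k i x) where
  blk k' i' hv' := by
    by_cases e : k' = k ∧ i' = i
    · obtain ⟨rfl, rfl⟩ := e
      simp [Store.setBlk]
    · have : blkAddr d k' i' ≠ blkAddr d k i := fun h' => e (blkAddr_inj hv' hv h')
      simp only [Function.update_of_ne this, Store.setBlk, if_neg e]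
      exact h.blk k' i' hv'
  mat k' i' j' hv' := by
    simp only [Function.update_of_ne (blkAddr_ne_matAddr hv hv').symm]
    exact h.mat k' i' j' hv'

theorem Rep.setEntry {d : ℕ} {σ : State} {M : Store} (h : Rep d σ M) {k i j : ℕ}
    (hv : MatValid d k i j) (x : ℝ) :
    Rep d ⟨σ.reg, Function.update σ.mem (matAddr d k i j) x⟩ (M.setEntry k i j x) where
  blk k' i' hv' := by
    simp only [Function.update_of_ne (blkAddr_ne_matAddr hv' hv)]
    exact h.blk k' i' hv'
  mat k' i' j' hv' := by
    by_cases e : k' = k ∧ i' = i ∧ j' = j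
    · obtain ⟨rfl, rfl, rfl⟩ := e
      simp [Store.setEntry]
    · have : matAddr d k' i' j' ≠ matAddr d k i j := fun h' => e (matAddr_inj hv' hv h')
      simp only [Function.update_of_ne this, Store.setEntry, if_neg e]
      exact h.mat k' i' j' hv'

/-- The address of the entry of block `k` whose index is held in register `r`. -/
def blkExp (k r : ℕ) : IExp :=
  .add (.add (.mul (.lit (blkOffset k)) (.mul (.var 0) (.var 0)))
    (.mul (.lit k) (.add (.var 0) (.lit 1)))) (.var r)

/-- The address of the entry of matrix `k` whose indices are held in registers `r` and `q`. -/
def matExp (k r q : ℕ) : IExp :=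
  .add (.add (.add (.mul (.lit 2) (.var 0)) (.lit 1)) (.mul (.lit k) (.mul (.var 0) (.var 0))))
    (.add (.mul (.var r) (.var 0)) (.var q))

def blkCell (k r : ℕ) : RExp := .cell (blkExp k r)

def matCell (k r q : ℕ) : RExp := .cell (matExp k r q)

/-- `e` evaluates to `x` without a fault. -/
def Val (S : ℕ) (σ : State) (e : RExp) (x : ℝ) : Prop := e.Safe S σ ∧ e.eval σ = x

/-- Register `0` holds `d`, registers `1` and `2` hold `m` and `f`, the memory holds `M`. -/
structure At (d m f : ℕ) (M : Store) (σ : State) : Prop where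
  dim : σ.reg 0 = d
  rank : σ.reg 1 = m
  flag : σ.reg 2 = f
  rep : Rep d σ M

section Val

variable {S : ℕ} {σ : State} {e e' : RExp} {x y : ℝ}

theorem Val.const (n : ℕ) : Val S σ (.const n) n := ⟨trivial, rfl⟩

theorem Val.add (h : Val S σ e x) (h' : Val S σ e' y) : Val S σ (.add e e') (x + y) :=
  ⟨⟨h.1, h'.1⟩, congrArg₂ _ h.2 h'.2⟩

theorem Val.sub (h : Val S σ e x) (h' : Val S σ e' y) : Val S σ (.sub e e') (x - y) :=
  ⟨⟨h.1, h'.1⟩, congrArg₂ _ h.2 h'.2⟩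

theorem Val.mul (h : Val S σ e x) (h' : Val S σ e' y) : Val S σ (.mul e e') (x * y) :=
  ⟨⟨h.1, h'.1⟩, congrArg₂ _ h.2 h'.2⟩

theorem Val.div (h : Val S σ e x) (h' : Val S σ e' y) (hy : y ≠ 0) :
    Val S σ (.div e e') (x / y) :=
  ⟨⟨h.1, h'.1, by rw [h'.2]; exact hy⟩, congrArg₂ _ h.2 h'.2⟩

theorem Val.sqrt (h : Val S σ e x) (hx : 0 ≤ x) : Val S σ (.sqrt e) (Real.sqrt x) :=
  ⟨⟨h.1, by rw [h.2]; exact hx⟩, congrArg _ h.2⟩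

theorem Val.congr (h : Val S σ e x) (hx : x = y) : Val S σ e y := hx ▸ h

end Val

section Access

variable {S d m f : ℕ} {M : Store} {σ : State}

theorem eval_blkExp (k r : ℕ) : (blkExp k r).eval σ = blkAddr (σ.reg 0) k (σ.reg r) := rfl

theorem eval_matExp (k r q : ℕ) :
    (matExp k r q).eval σ = matAddr (σ.reg 0) k (σ.reg r) (σ.reg q) := rfl

/-- The constant 100 is generous: the largest block address, 2d² + 8d + 7, is at most 17d². -/
theorem safe_blkExp (hd : 1 ≤ d) (hS : 100 * (d * d) ≤ S) (h0 : σ.reg 0 = d) {k r i : ℕ}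
    (hr : σ.reg r = i) (hv : BlkValid d k i) : (blkExp k r).Safe S σ ∧ blkAddr d k i < S := by
  obtain ⟨h1, h2, -⟩ := hv
  have hdd : d ≤ d * d := Nat.le_mul_self d
  have ho : blkOffset k ≤ 2 := by unfold blkOffset; split <;> omega
  have h3 : blkOffset k * (d * d) ≤ 2 * (d * d) := Nat.mul_le_mul_right _ ho
  have h4 : k * (d + 1) ≤ 8 * (d + 1) := Nat.mul_le_mul_right _ h1.le
  simp only [blkExp, IExp.Safe, IExp.eval, h0, hr, blkAddr]
  generalize d * d = D at *
  generalize blkOffset k * D = a at *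
  generalize k * (d + 1) = b at *
  refine ⟨⟨⟨⟨?_, ⟨?_, ?_, ?_⟩, ?_⟩, ⟨?_, ⟨?_, ?_, ?_⟩, ?_⟩, ?_⟩, ?_, ?_⟩, ?_⟩ <;> omega

theorem safe_matExp (hS : 100 * (d * d) ≤ S) (h0 : σ.reg 0 = d) {k r q i j : ℕ}
    (hr : σ.reg r = i) (hq : σ.reg q = j) (hv : MatValid d k i j) :
    (matExp k r q).Safe S σ ∧ matAddr d k i j < S := by
  obtain ⟨h1, h2, h3⟩ := hv
  have hdd : d ≤ d * d := Nat.le_mul_self d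
  have l := mul_add_lt h2 h3
  have h4 : k * (d * d) ≤ 2 * (d * d) := Nat.mul_le_mul_right _ h1.le
  simp only [matExp, IExp.Safe, IExp.eval, h0, hr, hq, matAddr]
  generalize i * d = a at *
  generalize d * d = D at *
  generalize k * D = b at *
  refine ⟨⟨⟨⟨⟨?_, ?_, ?_⟩, ?_, ?_⟩, ⟨?_, ⟨?_, ?_, ?_⟩, ?_⟩, ?_⟩, ⟨⟨?_, ?_, ?_⟩, ?_, ?_⟩, ?_⟩, ?_⟩ <;>
    omega

theorem At.blk (h : At d m f M σ) (hd : 1 ≤ d) (hS : 100 * (d * d) ≤ S) {k r i : ℕ}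
    (hr : σ.reg r = i) (hv : BlkValid d k i) : Val S σ (blkCell k r) (M.blk k i) := by
  obtain ⟨h1, h2⟩ := safe_blkExp hd hS h.dim hr hv
  have e : (blkExp k r).eval σ = blkAddr d k i := by rw [eval_blkExp, h.dim, hr]
  refine ⟨⟨h1, by rw [e]; exact h2⟩, ?_⟩
  change σ.mem ((blkExp k r).eval σ) = _
  rw [e, h.rep.blk k i hv]

theorem At.mat (h : At d m f M σ) (hS : 100 * (d * d) ≤ S) {k r q i j : ℕ}
    (hr : σ.reg r = i) (hq : σ.reg q = j) (hv : MatValid d k i j) :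
    Val S σ (matCell k r q) (M.mat k i j) := by
  obtain ⟨h1, h2⟩ := safe_matExp hS h.dim hr hq hv
  have e : (matExp k r q).eval σ = matAddr d k i j := by rw [eval_matExp, h.dim, hr, hq]
  refine ⟨⟨h1, by rw [e]; exact h2⟩, ?_⟩
  change σ.mem ((matExp k r q).eval σ) = _
  rw [e, h.rep.mat k i j hv]

end Access

/-- Started in `σ`, the command `p` halts within `T` steps in a state that satisfies `Q`. -/
def Run (S : ℕ) (p : Cmd) (σ : State) (Q : State → Prop) (T : ℕ) : Prop :=
  ∃ σ' T', T' ≤ T ∧ Exec S p σ σ' T' ∧ Q σ'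

/-! ### Reasoning about commands with step bounds. -/

section Run

variable {S d m f : ℕ} {p q : Cmd} {σ : State} {Q R : State → Prop} {T T' : ℕ} {M : Store}

theorem Run.seq (h : Run S p σ Q T) (h' : ∀ σ', Q σ' → Run S q σ' R T') :
    Run S (.seq p q) σ R (T + T') := by
  obtain ⟨σ₁, T₁, l₁, e₁, q₁⟩ := h
  obtain ⟨σ₂, T₂, l₂, e₂, q₂⟩ := h' σ₁ q₁
  exact ⟨σ₂, T₁ + T₂, by omega, .seq e₁ e₂, q₂⟩

theorem Run.mono (h : Run S p σ Q T) (hQ : ∀ σ', Q σ' → R σ') (hT : T ≤ T') :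
    Run S p σ R T' := by
  obtain ⟨σ₁, T₁, l₁, e₁, q₁⟩ := h
  exact ⟨σ₁, T₁, l₁.trans hT, e₁, hQ _ q₁⟩

theorem run_storeBlk (hd : 1 ≤ d) (hS : 100 * (d * d) ≤ S) (h : At d m f M σ) {k r i : ℕ}
    (hr : σ.reg r = i) (hv : BlkValid d k i) {e : RExp} {x : ℝ} (he : Val S σ e x) :
    Run S (.store (blkExp k r) e) σ
      (fun σ' => At d m f (M.setBlk k i x) σ' ∧ σ'.reg = σ.reg) (e.cost + 14) := by
  obtain ⟨h1, h2⟩ := safe_blkExp hd hS h.dim hr hv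
  have e1 : (blkExp k r).eval σ = blkAddr d k i := by rw [eval_blkExp, h.dim, hr]
  refine ⟨_, _, ?_, Exec.store _ _ σ h1 (by rw [e1]; exact h2) he.1, ?_, rfl⟩
  · simp only [blkExp, IExp.cost]; omega
  · rw [e1, he.2]
    exact ⟨h.dim, h.rank, h.flag, h.rep.setBlk hv x⟩

theorem run_storeMat (hS : 100 * (d * d) ≤ S) (h : At d m f M σ) {k r q i j : ℕ}
    (hr : σ.reg r = i) (hq : σ.reg q = j) (hv : MatValid d k i j) {e : RExp} {x : ℝ}
    (he : Val S σ e x) :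
    Run S (.store (matExp k r q) e) σ
      (fun σ' => At d m f (M.setEntry k i j x) σ' ∧ σ'.reg = σ.reg) (e.cost + 18) := by
  obtain ⟨h1, h2⟩ := safe_matExp hS h.dim hr hq hv
  have e1 : (matExp k r q).eval σ = matAddr d k i j := by rw [eval_matExp, h.dim, hr, hq]
  refine ⟨_, _, ?_, Exec.store _ _ σ h1 (by rw [e1]; exact h2) he.1, ?_, rfl⟩
  · simp only [matExp, IExp.cost]; omega
  · rw [e1, he.2]
    exact ⟨h.dim, h.rank, h.flag, h.rep.setEntry hv x⟩

/-- Run `p` with register `r` counting from `0` to `d - 1`. -/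
def forLoop (r : ℕ) (p : Cmd) : Cmd :=
  .seq (.assign r (.lit 0))
    (.loop (.idxLT (.var r) (.var 0)) (.seq p (.assign r (.add (.var r) (.lit 1)))))

/-- The invariant must survive arbitrary changes of the counter register, since the loop itself
resets and increments it. -/
theorem run_forLoop (hd : 1 ≤ d) (hS : 100 * (d * d) ≤ S) {r : ℕ}
    (I : ℕ → State → Prop) (hdim : ∀ i σ, I i σ → σ.reg 0 = d)
    (hreg : ∀ i σ v, I i σ → I i ⟨Function.update σ.reg r v, σ.mem⟩)
    (hbody : ∀ i < d, ∀ σ, I i σ → σ.reg r = i →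
      Run S p σ (fun σ' => I (i + 1) σ' ∧ σ'.reg r = i) T) (h : I 0 σ) :
    Run S (forLoop r p) σ (I d) (d * (T + 8) + 8) := by
  have hdd : d ≤ d * d := Nat.le_mul_self d
  have hsafe : ∀ i σ, I i σ → σ.reg r ≤ d →
      (BExp.idxLT (.var r) (.var 0)).Safe S σ := by
    intro i σ hI hle
    refine ⟨?_, ?_⟩
    · simp only [IExp.Safe]; omega
    · simp only [IExp.Safe, hdim i σ hI]; omega
  have hloop : ∀ n i, i + n = d → ∀ σ, I i σ → σ.reg r = i →
      Run S (.loop (.idxLT (.var r) (.var 0)) (.seq p (.assign r (.add (.var r) (.lit 1))))) σ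
        (I d) (n * (T + 8) + 4) := by
    intro n
    induction n with
    | zero =>
      intro i hi σ hI hσ
      refine ⟨σ, _, ?_, Exec.loopDone (hsafe i σ hI (by omega)) ?_, ?_⟩
      · simp [BExp.cost, IExp.cost]
      · simp only [BExp.eval, IExp.eval, hdim i σ hI]; omega
      · have : i = d := by omega
        exact this ▸ hI
    | succ n ih =>
      intro i hi σ hI hσ
      obtain ⟨σ₁, T₁, l₁, e₁, hI₁, hr₁⟩ := hbody i (by omega) σ hI hσ
      have e₂ : Exec S (.assign r (.add (.var r) (.lit 1))) σ₁ _ _ :=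
        Exec.assign r (.add (.var r) (.lit 1)) σ₁ (by simp only [IExp.Safe, IExp.eval]; omega)
      obtain ⟨σ₃, T₃, l₃, e₃, q₃⟩ := ih (i + 1) (by omega) _
        (hreg _ _ ((IExp.add (.var r) (.lit 1)).eval σ₁) hI₁) (by simp [IExp.eval, hr₁])
      refine ⟨σ₃, _, ?_, Exec.loopStep (hsafe i σ hI (by omega)) ?_ (.seq e₁ e₂) e₃, q₃⟩
      · simp only [BExp.cost, IExp.cost]
        rw [Nat.succ_mul]
        omega
      · simp only [BExp.eval, IExp.eval, hdim i σ hI]; omega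
  have e₁ : Exec S (.assign r (.lit 0)) σ _ _ :=
    Exec.assign r (.lit 0) σ (Nat.zero_le S)
  obtain ⟨σ₂, T₂, l₂, e₂, q₂⟩ := hloop d 0 (zero_add d) _ (hreg _ _ 0 h) (by simp)
  refine ⟨σ₂, _, ?_, .seq e₁ e₂, q₂⟩
  simp only [IExp.cost]
  omega

theorem At.update_reg (h : At d m f M σ) {r v : ℕ} (hr : 3 ≤ r) :
    At d m f M ⟨Function.update σ.reg r v, σ.mem⟩ := by
  refine ⟨?_, ?_, ?_, ⟨h.rep.blk, h.rep.mat⟩⟩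
  · simpa [Function.update_of_ne (show 0 ≠ r by omega)] using h.dim
  · simpa [Function.update_of_ne (show 1 ≠ r by omega)] using h.rank
  · simpa [Function.update_of_ne (show 2 ≠ r by omega)] using h.flag

theorem At.congr {M' : Store} (h : At d m f M σ)
    (hb : ∀ k i, BlkValid d k i → M.blk k i = M'.blk k i)
    (hm : ∀ k i j, MatValid d k i j → M.mat k i j = M'.mat k i j) : At d m f M' σ :=
  ⟨h.dim, h.rank, h.flag, h.rep.congr hb hm⟩

/-- The outer loop uses register `3`. -/
theorem run_outer (hd : 1 ≤ d) (hS : 100 * (d * d) ≤ S) (A : ℕ → Store)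
    (hbody : ∀ i < d, ∀ σ, At d m f (A i) σ → σ.reg 3 = i →
      Run S p σ (fun σ' => At d m f (A (i + 1)) σ' ∧ σ'.reg 3 = i) T)
    (h : At d m f (A 0) σ) :
    Run S (forLoop 3 p) σ (At d m f (A d)) (d * (T + 8) + 8) :=
  run_forLoop hd hS (fun i => At d m f (A i)) (fun _ _ h => h.dim)
    (fun _ _ _ h => h.update_reg le_rfl) hbody h

/-- The inner loop uses register `4`. -/
theorem run_inner (hd : 1 ≤ d) (hS : 100 * (d * d) ≤ S) (A : ℕ → Store) {i : ℕ}
    (hbody : ∀ j < d, ∀ σ, At d m f (A j) σ → σ.reg 3 = i → σ.reg 4 = j →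
      Run S p σ (fun σ' => At d m f (A (j + 1)) σ' ∧ σ'.reg = σ.reg) T)
    (h : At d m f (A 0) σ) (hi : σ.reg 3 = i) :
    Run S (forLoop 4 p) σ (fun σ' => At d m f (A d) σ' ∧ σ'.reg 3 = i) (d * (T + 8) + 8) := by
  refine run_forLoop hd hS (fun j σ => At d m f (A j) σ ∧ σ.reg 3 = i)
    (fun _ _ h => h.1.dim) (fun _ σ v h => ⟨h.1.update_reg (by norm_num), ?_⟩) ?_ ⟨h, hi⟩
  · simpa [Function.update_of_ne (show 3 ≠ 4 by norm_num)] using h.2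
  · intro j hj σ hσ hj'
    refine (hbody j hj σ hσ.1 hσ.2 hj').mono (fun σ' h' => ⟨⟨h'.1, ?_⟩, ?_⟩) le_rfl
    · rw [h'.2]; exact hσ.2
    · rw [h'.2]; exact hj'

end Run

/-! ### Loops that fill vectors and matrices or accumulate sums. -/

theorem BlkValid.vec {d k i : ℕ} (hk : k < 8) (hi : i < d) : BlkValid d k i :=
  ⟨hk, hi.le, fun _ => hi⟩

/-- Entry d of a block serves as a scalar variable. As register 0 holds d, `blkExp k 0` addresses
it. -/
theorem BlkValid.scalar {d k : ℕ} (hk : k < 8) (hk1 : k ≠ 1) : BlkValid d k d :=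
  ⟨hk, le_rfl, fun h => absurd h hk1⟩

/-- Store the values of `e` in block `k`. -/
def vecLoop (k : ℕ) (e : RExp) : Cmd := forLoop 3 (.store (blkExp k 3) e)

/-- Store the values of `e` in the row of matrix `k` whose index is held in register `r`. -/
def rowLoop (k r : ℕ) (e : RExp) : Cmd := forLoop 3 (.store (matExp k r 3) e)

/-- Store the values of `e` in the column of matrix `k` whose index is held in register `r`. -/
def colLoop (k r : ℕ) (e : RExp) : Cmd := forLoop 3 (.store (matExp k 3 r) e)

/-- Store the values of `e` in matrix `k`. -/
def matLoop (k : ℕ) (e : RExp) : Cmd := forLoop 3 (forLoop 4 (.store (matExp k 3 4) e))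

/-- Add the values of `e` to the entry of block `k` whose index is held in register `r`. -/
def accLoop (k r : ℕ) (e : RExp) : Cmd :=
  forLoop 4 (.store (blkExp k r) (.add (blkCell k r) e))

/-- Store `e₀ + ∑ e` in block `k`, where the sum is over register `4`. -/
def sumLoop (k : ℕ) (e₀ e : RExp) : Cmd :=
  forLoop 3 (.seq (.store (blkExp k 3) e₀) (accLoop k 3 e))

/-- Store `∑ e` in the scalar of block `k`, where the sum is over register `4`. -/
def dotLoop (k : ℕ) (e : RExp) : Cmd :=
  .seq (.store (blkExp k 0) (.const 0)) (accLoop k 0 e)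

section Loops

variable {S d m f : ℕ} {M : Store} {σ : State}

theorem run_vecLoop (hd : 1 ≤ d) (hS : 100 * (d * d) ≤ S) (h : At d m f M σ) {k : ℕ}
    (hk : k < 8) {e : RExp} {F : ℕ → ℝ}
    (he : ∀ i < d, ∀ σ, At d m f (M.setVec k i F) σ → σ.reg 3 = i → Val S σ e (F i)) :
    Run S (vecLoop k e) σ (At d m f (M.setVec k d F)) (d * (e.cost + 14 + 8) + 8) := by
  refine run_outer hd hS (fun i => M.setVec k i F) (fun i hi σ hσ h3 => ?_)
    (h.congr (by simp [Store.setVec]) (by simp [Store.setVec]))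
  refine (run_storeBlk hd hS hσ h3 (.vec hk hi) (he i hi σ hσ h3)).mono (fun σ' h' => ⟨?_, ?_⟩)
    le_rfl
  · refine h'.1.congr (fun k' i' _ => ?_) (fun _ _ _ _ => rfl)
    simp only [Store.setVec, Store.setBlk]
    grind
  · rw [h'.2, h3]

theorem run_rowLoop (hd : 1 ≤ d) (hS : 100 * (d * d) ≤ S) (h : At d m f M σ) {k : ℕ}
    (hk : k < 2) (hm : m < d) {e : RExp} {F : ℕ → ℝ}
    (he : ∀ i < d, ∀ σ, At d m f (M.setRow k m i F) σ → σ.reg 3 = i → Val S σ e (F i)) :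
    Run S (rowLoop k 1 e) σ (At d m f (M.setRow k m d F)) (d * (e.cost + 18 + 8) + 8) := by
  refine run_outer hd hS (fun i => M.setRow k m i F) (fun i hi σ hσ h3 => ?_)
    (h.congr (by simp [Store.setRow]) (by simp [Store.setRow]))
  refine (run_storeMat hS hσ hσ.rank h3 ⟨hk, hm, hi⟩ (he i hi σ hσ h3)).mono
    (fun σ' h' => ⟨?_, ?_⟩) le_rfl
  · refine h'.1.congr (fun _ _ _ => rfl) (fun k' i' j' _ => ?_)
    simp only [Store.setRow, Store.setEntry]
    grind
  · rw [h'.2, h3]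

theorem run_colLoop (hd : 1 ≤ d) (hS : 100 * (d * d) ≤ S) (h : At d m f M σ) {k : ℕ}
    (hk : k < 2) (hm : m < d) {e : RExp} {F : ℕ → ℝ}
    (he : ∀ i < d, ∀ σ, At d m f (M.setCol k m i F) σ → σ.reg 3 = i → Val S σ e (F i)) :
    Run S (colLoop k 1 e) σ (At d m f (M.setCol k m d F)) (d * (e.cost + 18 + 8) + 8) := by
  refine run_outer hd hS (fun i => M.setCol k m i F) (fun i hi σ hσ h3 => ?_)
    (h.congr (by simp [Store.setCol]) (by simp [Store.setCol]))
  refine (run_storeMat hS hσ h3 hσ.rank ⟨hk, hi, hm⟩ (he i hi σ hσ h3)).mono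
    (fun σ' h' => ⟨?_, ?_⟩) le_rfl
  · refine h'.1.congr (fun _ _ _ => rfl) (fun k' i' j' _ => ?_)
    simp only [Store.setCol, Store.setEntry]
    grind
  · rw [h'.2, h3]

/-- `he` sees the matrix with exactly the earlier entries overwritten, so `e` may read the old entry
(i, j) and the update can be done in place. -/
theorem run_matLoop (hd : 1 ≤ d) (hS : 100 * (d * d) ≤ S) (h : At d m f M σ) {k : ℕ}
    (hk : k < 2) {e : RExp} {F : ℕ → ℕ → ℝ}
    (he : ∀ i < d, ∀ j < d, ∀ σ, At d m f ((M.setMat k i F).setRow k i j (F i)) σ →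
      σ.reg 3 = i → σ.reg 4 = j → Val S σ e (F i j)) :
    Run S (matLoop k e) σ (At d m f (M.setMat k d F))
      (d * (d * (e.cost + 18 + 8) + 8 + 8) + 8) := by
  refine run_outer hd hS (fun i => M.setMat k i F) (fun i hi σ hσ h3 => ?_)
    (h.congr (by simp [Store.setMat]) (by simp [Store.setMat]))
  refine (run_inner hd hS (T := e.cost + 18) (fun j => (M.setMat k i F).setRow k i j (F i))
    (fun j hj σ hσ h3 h4 => ?_) (hσ.congr (by simp [Store.setRow])
      (by simp [Store.setRow])) h3).mono (fun σ' h' => ⟨?_, h'.2⟩) le_rfl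
  · refine (run_storeMat hS hσ h3 h4 ⟨hk, hi, hj⟩ (he i hi j hj σ hσ h3 h4)).mono
      (fun σ' h' => ⟨?_, h'.2⟩) le_rfl
    refine h'.1.congr (fun _ _ _ => rfl) (fun k' i' j' _ => ?_)
    simp only [Store.setRow, Store.setEntry]
    grind
  · refine h'.1.congr (fun _ _ _ => rfl) (fun k' i' j' hv => ?_)
    have := hv.2.2
    simp only [Store.setRow, Store.setMat]
    grind

theorem run_accLoop (hd : 1 ≤ d) (hS : 100 * (d * d) ≤ S) (h : At d m f M σ) {k r i i₃ : ℕ}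
    (hri : r = 0 ∧ i = d ∨ r = 3 ∧ i = i₃) (hv : BlkValid d k i) (h3 : σ.reg 3 = i₃) {e : RExp}
    {F : ℕ → ℝ}
    (he : ∀ j < d, ∀ x σ, At d m f (M.setBlk k i x) σ → σ.reg 3 = i₃ → σ.reg 4 = j →
      Val S σ e (F j)) :
    Run S (accLoop k r e) σ (fun σ' => At d m f (M.setBlk k i
      (M.blk k i + ∑ j ∈ Finset.range d, F j)) σ' ∧ σ'.reg 3 = i₃)
      (d * (e.cost + 29 + 8) + 8) := by
  refine run_inner hd hS (T := e.cost + 29) (fun j => M.setBlk k i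
    (M.blk k i + ∑ j ∈ Finset.range j, F j)) (fun j hj σ hσ h3 h4 => ?_) (h.congr
      (fun k' i' _ => ?_) (fun _ _ _ _ => rfl)) h3
  · have hr : σ.reg r = i := by
      rcases hri with ⟨rfl, rfl⟩ | ⟨rfl, rfl⟩
      · exact hσ.dim
      · exact h3
    refine (run_storeBlk hd hS hσ hr hv
      ((hσ.blk hd hS hr hv).add (he j hj _ σ hσ h3 h4))).mono (fun σ' h' => ⟨?_, h'.2⟩) ?_
    · refine h'.1.congr (fun k' i' _ => ?_) (fun _ _ _ _ => rfl)
      simp only [Store.setBlk, Finset.sum_range_succ]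
      grind
    · simp only [RExp.cost, blkCell, blkExp, IExp.cost]; omega
  · simp only [Store.setBlk, Finset.range_zero, Finset.sum_empty, add_zero]
    grind

/-- Quantifying over `G` and `x` means that the summands must not depend on the entries being
written. -/
theorem run_sumLoop (hd : 1 ≤ d) (hS : 100 * (d * d) ≤ S) (h : At d m f M σ) {k : ℕ}
    (hk : k < 8) {e₀ e : RExp} {F₀ : ℕ → ℝ} {F : ℕ → ℕ → ℝ}
    (he₀ : ∀ i < d, ∀ G σ, At d m f (M.setVec k i G) σ → σ.reg 3 = i → Val S σ e₀ (F₀ i))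
    (he : ∀ i < d, ∀ j < d, ∀ G x σ, At d m f ((M.setVec k i G).setBlk k i x) σ →
      σ.reg 3 = i → σ.reg 4 = j → Val S σ e (F i j)) :
    Run S (sumLoop k e₀ e) σ
      (At d m f (M.setVec k d fun i => F₀ i + ∑ j ∈ Finset.range d, F i j))
      (d * (e₀.cost + 14 + (d * (e.cost + 29 + 8) + 8) + 8) + 8) := by
  refine run_outer hd hS (fun i => M.setVec k i fun i => F₀ i + ∑ j ∈ Finset.range d, F i j)
    (fun i hi σ hσ h3 => ?_) (h.congr (by simp [Store.setVec]) (by simp [Store.setVec]))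
  refine (run_storeBlk hd hS hσ h3 (.vec hk hi) (he₀ i hi _ σ hσ h3)).seq (fun σ₁ h₁ => ?_)
  refine (run_accLoop hd hS h₁.1 (Or.inr ⟨rfl, rfl⟩) (.vec hk hi) (by rw [h₁.2, h3])
    (F := F i) (fun j hj x σ hσ h3 h4 => he i hi j hj
      (fun i => F₀ i + ∑ j ∈ Finset.range d, F i j) x σ (hσ.congr (fun k' i' _ => ?_)
      (fun _ _ _ _ => rfl)) h3 h4)).mono (fun σ' h' => ⟨?_, h'.2⟩) le_rfl
  · simp only [Store.setBlk]
    grind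
  · refine h'.1.congr (fun k' i' _ => ?_) (fun _ _ _ _ => rfl)
    simp only [Store.setBlk, Store.setVec]
    grind

theorem run_dotLoop (hd : 1 ≤ d) (hS : 100 * (d * d) ≤ S) (h : At d m f M σ) {k : ℕ}
    (hk : k < 8) (hk1 : k ≠ 1) {e : RExp} {F : ℕ → ℝ}
    (he : ∀ j < d, ∀ x σ, At d m f (M.setBlk k d x) σ → σ.reg 4 = j → Val S σ e (F j)) :
    Run S (dotLoop k e) σ (At d m f (M.setBlk k d (∑ j ∈ Finset.range d, F j)))
      (15 + (d * (e.cost + 29 + 8) + 8)) := by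
  refine Run.seq (T := 15) (run_storeBlk hd hS h h.dim (.scalar hk hk1) (.const 0))
    (fun σ₁ h₁ => ?_)
  refine (run_accLoop hd hS h₁.1 (Or.inl ⟨rfl, rfl⟩) (.scalar hk hk1) rfl (F := F)
    (fun j hj x σ hσ _ h4 => he j hj x σ (hσ.congr (fun k' i' _ => ?_)
      (fun _ _ _ _ => rfl)) h4)).mono (fun σ' h' => ?_) le_rfl
  · simp only [Store.setBlk]
    grind
  · refine h'.1.congr (fun k' i' _ => ?_) (fun _ _ _ _ => rfl)
    simp only [Store.setBlk]
    grind

end Loops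

/-! ### The programs of the update and their effect on the memory. -/

/-- Block `0` holds the arriving point and, in its last entry, the scaling factor; block `1` holds
the center. -/
noncomputable def Store.diff (M : Store) (i : ℕ) : ℝ := M.blk 0 i - M.blk 1 i

noncomputable def Store.coord (M : Store) (d i : ℕ) : ℝ :=
  ∑ j ∈ Finset.range d, M.mat 1 i j * M.diff j

noncomputable def Store.resid (M : Store) (d i : ℕ) : ℝ :=
  M.diff i + ∑ j ∈ Finset.range d, (0 - M.mat 0 i j * M.coord d j)

noncomputable def Store.residSq (M : Store) (d : ℕ) : ℝ :=
  ∑ i ∈ Finset.range d, M.resid d i * M.resid d i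

noncomputable def Store.coordSq (M : Store) (d : ℕ) : ℝ :=
  ∑ i ∈ Finset.range d, M.coord d i * M.coord d i

/-- The vectors are y = z - c, u = Gy and v = y - Bu; the scalars ‖v‖² and ‖u‖² decide which case
applies. -/
noncomputable def Store.prepared (M : Store) (d : ℕ) : Store :=
  ((((M.setVec 2 d M.diff).setVec 3 d (M.coord d)).setVec 4 d (M.resid d)).setBlk 2 d
    (M.residSq d)).setBlk 3 d (M.coordSq d)

/-- Compute the position of the arriving point relative to the ellipsoid. -/
def prepare : Cmd :=
  .seq (vecLoop 2 (.sub (blkCell 0 3) (blkCell 1 3)))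
  (.seq (sumLoop 3 (.const 0) (.mul (matCell 1 3 4) (blkCell 2 4)))
  (.seq (sumLoop 4 (blkCell 2 3) (.sub (.const 0) (.mul (matCell 0 3 4) (blkCell 3 4))))
  (.seq (dotLoop 2 (.mul (blkCell 4 4) (blkCell 4 4)))
    (dotLoop 3 (.mul (blkCell 3 4) (blkCell 3 4))))))

section Prepare

variable {S d m f : ℕ} {M : Store} {σ : State}

theorem run_prepare (hd : 1 ≤ d) (hS : 100 * (d * d) ≤ S) (h : At d m f M σ) :
    Run S prepare σ (At d m f (M.prepared d)) (2000 * (d * d)) := by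
  have hdd : d ≤ d * d := Nat.le_mul_self d
  refine Run.mono (T := _ + (_ + (_ + (_ + _)))) (R := At d m f (M.prepared d))
    (Run.seq (run_vecLoop hd hS h (F := M.diff) (by norm_num) ?_) fun σ₁ h₁ =>
     Run.seq (run_sumLoop hd hS h₁ (F₀ := fun _ => 0) (F := fun i j => M.mat 1 i j * M.diff j)
       (by norm_num) ?_ ?_) fun σ₂ h₂ =>
     Run.seq (run_sumLoop hd hS h₂ (F₀ := M.diff)
       (F := fun i j => 0 - M.mat 0 i j * M.coord d j) (by norm_num) ?_ ?_) fun σ₃ h₃ =>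
     Run.seq (run_dotLoop hd hS h₃ (F := fun i => M.resid d i * M.resid d i)
       (by norm_num) (by norm_num) ?_) fun σ₄ h₄ =>
     run_dotLoop hd hS h₄ (F := fun i => M.coord d i * M.coord d i)
       (by norm_num) (by norm_num) ?_) ?_ ?_
  · intro i hi σ hσ h3
    refine ((hσ.blk hd hS h3 (.vec (by norm_num) hi)).sub
      (hσ.blk hd hS h3 (.vec (by norm_num) hi))).congr ?_
    simp [Store.setVec, Store.diff]
  · intro i hi G σ hσ h3
    exact (Val.const 0).congr (by simp)
  · intro i hi j hj G x σ hσ h3 h4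
    refine ((hσ.mat hS h3 h4 ⟨by norm_num, hi, hj⟩).mul
      (hσ.blk hd hS h4 (.vec (by norm_num) hj))).congr ?_
    simp [Store.setVec, Store.setBlk, hj]
  · intro i hi G σ hσ h3
    refine (hσ.blk hd hS h3 (.vec (by norm_num) hi)).congr ?_
    simp [Store.setVec, hi]
  · intro i hi j hj G x σ hσ h3 h4
    refine ((Val.const 0).sub ((hσ.mat hS h3 h4 ⟨by norm_num, hi, hj⟩).mul
      (hσ.blk hd hS h4 (.vec (by norm_num) hj)))).congr ?_
    simp [Store.setVec, Store.setBlk, hj, Store.coord]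
  · intro j hj x σ hσ h4
    refine ((hσ.blk hd hS h4 (.vec (by norm_num) hj)).mul
      (hσ.blk hd hS h4 (.vec (by norm_num) hj))).congr ?_
    simp [Store.setVec, Store.setBlk, hj, Store.resid]
  · intro j hj x σ hσ h4
    refine ((hσ.blk hd hS h4 (.vec (by norm_num) hj)).mul
      (hσ.blk hd hS h4 (.vec (by norm_num) hj))).congr ?_
    simp [Store.setVec, Store.setBlk, hj, Store.coord, hj.ne]
  · intro σ' h'
    refine h'.congr (fun k i _ => ?_) (fun _ _ _ _ => rfl)
    simp only [Store.prepared, Store.setVec, Store.setBlk, zero_add, Store.resid, Store.coord,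
      Store.residSq, Store.coordSq]
  · simp only [RExp.cost, blkCell, matCell, blkExp, matExp, IExp.cost]
    nlinarith

end Prepare

/-- The arriving point does not lie in the affine span of the ellipsoid. -/
def grow : Cmd :=
  .seq (matLoop 1 (.div (.sub (matCell 1 3 4)
    (.div (.mul (blkCell 3 3) (blkCell 4 4)) (blkCell 2 0))) (.add (.const 1) (blkCell 0 0))))
  (.seq (rowLoop 1 1 (.div (blkCell 4 3) (blkCell 2 0)))
  (.seq (matLoop 0 (.mul (.add (.const 1) (blkCell 0 0)) (matCell 0 3 4)))
  (.seq (colLoop 0 1 (blkCell 2 3))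
  (.seq (.store (blkExp 0 0)
    (.div (blkCell 0 0) (.add (.const 1) (.mul (.const 12) (blkCell 0 0)))))
  (.seq (vecLoop 1 (.add (blkCell 1 3) (.mul (blkCell 0 0) (blkCell 2 3))))
    (.assign 1 (.add (.var 1) (.lit 1))))))))

/-- Both matrices use the old α, the center the new one; hence the place of the write to block 0. -/
noncomputable def Store.grown (M : Store) (d m : ℕ) : Store :=
  let P := M.prepared d
  let a := M.blk 0 d
  (((((P.setMat 1 d fun i j => (M.mat 1 i j - M.coord d i * M.resid d j / M.residSq d) / (1 + a)
    ).setRow 1 m d fun j => M.resid d j / M.residSq d).setMat 0 d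
      fun i j => (1 + a) * M.mat 0 i j).setCol 0 m d M.diff).setBlk 0 d (a / (1 + 12 * a))).setVec 1 d
      fun i => M.blk 1 i + a / (1 + 12 * a) * M.diff i

section Grow

variable {S d m f : ℕ} {M : Store} {σ : State}

theorem run_grow (hd : 1 ≤ d) (hS : 100 * (d * d) ≤ S) (hm : m < d) (hα : 0 < M.blk 0 d)
    (hs : M.residSq d ≠ 0) (h : At d m f (M.prepared d) σ) :
    Run S grow σ (At d (m + 1) f (M.grown d m)) (2000 * (d * d)) := by
  have hdd : d ≤ d * d := Nat.le_mul_self d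
  set a := M.blk 0 d with ha
  have ha1 : 1 + a ≠ 0 := by positivity
  have ha2 : 1 + 12 * a ≠ 0 := by positivity
  refine Run.mono (T := _ + (_ + (_ + (_ + (200 + (_ + 4))))))
    (Q := At d (m + 1) f (M.grown d m))
    (Run.seq (run_matLoop hd hS h (by norm_num)
      (F := fun i j => (M.mat 1 i j - M.coord d i * M.resid d j / M.residSq d) / (1 + a))
      ?_) fun σ₁ h₁ =>
     Run.seq (run_rowLoop hd hS h₁ (F := fun j => M.resid d j / M.residSq d) (by norm_num) hm
       ?_) fun σ₂ h₂ =>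
     Run.seq (run_matLoop hd hS h₂ (by norm_num) (F := fun i j => (1 + a) * M.mat 0 i j)
      ?_) fun σ₃ h₃ =>
     Run.seq (run_colLoop hd hS h₃ (F := M.diff) (by norm_num) hm ?_) fun σ₄ h₄ =>
     Run.seq (Run.mono (run_storeBlk hd hS h₄ (x := a / (1 + 12 * a)) h₄.dim
       (.scalar (by norm_num) (by norm_num)) ?_) (fun σ' h' => h'.1) (by decide)) fun σ₅ h₅ =>
     Run.seq (run_vecLoop hd hS h₅ (F := fun i => M.blk 1 i + a / (1 + 12 * a) * M.diff i)
       (by norm_num) ?_) fun σ₆ h₆ => ?_) (fun _ h => h) ?_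
  · intro i hi j hj σ hσ h3 h4
    refine (((hσ.mat hS h3 h4 ⟨by norm_num, hi, hj⟩).sub
      (((hσ.blk hd hS h3 (.vec (by norm_num) hi)).mul
      (hσ.blk hd hS h4 (.vec (by norm_num) hj))).div
      (hσ.blk hd hS hσ.dim (.scalar (by norm_num) (by norm_num))) ?_)).div
      ((Val.const 1).add (hσ.blk hd hS hσ.dim (.scalar (by norm_num) (by norm_num)))) ?_).congr ?_
    · simpa [Store.setMat, Store.setRow, Store.prepared, Store.setBlk, Store.setVec] using hs
    · simpa [Store.setMat, Store.setRow, Store.prepared, Store.setBlk, Store.setVec] using ha1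
    · simp [Store.setMat, Store.setRow, Store.prepared, Store.setBlk, Store.setVec, hi, hj, hi.ne,
        hj.ne, ← ha]
  · intro i hi σ hσ h3
    refine ((hσ.blk hd hS h3 (.vec (by norm_num) hi)).div
      (hσ.blk hd hS hσ.dim (.scalar (by norm_num) (by norm_num))) ?_).congr ?_
    · simpa [Store.setMat, Store.setRow, Store.prepared, Store.setBlk, Store.setVec] using hs
    · simp [Store.setMat, Store.setRow, Store.prepared, Store.setBlk, Store.setVec, hi]
  · intro i hi j hj σ hσ h3 h4
    refine (((Val.const 1).add (hσ.blk hd hS hσ.dim (.scalar (by norm_num) (by norm_num)))).mul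
      (hσ.mat hS h3 h4 ⟨by norm_num, hi, hj⟩)).congr ?_
    simp [Store.setMat, Store.setRow, Store.prepared, Store.setBlk, Store.setVec, ← ha]
  · intro i hi σ hσ h3
    refine (hσ.blk hd hS h3 (.vec (by norm_num) hi)).congr ?_
    simp [Store.setMat, Store.setRow, Store.setCol, Store.prepared, Store.setBlk, Store.setVec,
      hi, hi.ne]
  · refine ((h₄.blk hd hS h₄.dim (.scalar (by norm_num) (by norm_num))).div
      ((Val.const 1).add ((Val.const 12).mul
      (h₄.blk hd hS h₄.dim (.scalar (by norm_num) (by norm_num))))) ?_).congr ?_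
    · simpa [Store.setMat, Store.setRow, Store.setCol, Store.prepared, Store.setBlk,
        Store.setVec] using ha2
    · simp [Store.setMat, Store.setRow, Store.setCol, Store.prepared, Store.setBlk,
        Store.setVec, ← ha]
  · intro i hi σ hσ h3
    refine ((hσ.blk hd hS h3 (.vec (by norm_num) hi)).add
      ((hσ.blk hd hS hσ.dim (.scalar (by norm_num) (by norm_num))).mul
      (hσ.blk hd hS h3 (.vec (by norm_num) hi)))).congr ?_
    simp [Store.setMat, Store.setRow, Store.setCol, Store.prepared, Store.setBlk, Store.setVec,
      hi, hi.ne]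
  · refine ⟨_, _, le_rfl, Exec.assign 1 (.add (.var 1) (.lit 1)) σ₆ ?_, ?_⟩
    · simp only [IExp.Safe, IExp.eval, h₆.rank]
      omega
    · refine ⟨?_, ?_, ?_, ?_⟩
      · simpa using h₆.dim
      · simp [IExp.eval, h₆.rank]
      · simpa using h₆.flag
      · exact ⟨h₆.rep.blk, h₆.rep.mat⟩
  · simp only [RExp.cost, blkCell, matCell, blkExp, matExp, IExp.cost]
    nlinarith

end Grow

/-- The arriving point lies in the affine span of the ellipsoid, but outside of it. -/
def stretch : Cmd :=
  .seq (.store (blkExp 4 0) (.sqrt (blkCell 3 0)))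
  (.seq (.store (blkExp 5 0) (.add (.const 1) (.mul (blkCell 0 0)
    (.sub (.const 1) (.div (.const 1) (blkCell 4 0))))))
  (.seq (.store (blkExp 6 0) (.div (blkCell 0 0) (.add (.const 1) (.mul
    (.mul (.const 4) (blkCell 0 0)) (.sub (.const 1) (.div (.const 1) (blkCell 4 0)))))))
  (.seq (sumLoop 5 (.const 0) (.mul (blkCell 3 4) (matCell 1 4 3)))
  (.seq (matLoop 1 (.div (.add (matCell 1 3 4) (.mul
    (.div (.sub (.div (blkCell 5 0) (blkCell 4 0)) (.const 1)) (blkCell 3 0))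
    (.mul (blkCell 3 3) (blkCell 5 4)))) (blkCell 5 0)))
  (.seq (matLoop 0 (.add (.mul (blkCell 5 0) (matCell 0 3 4)) (.mul
    (.div (.sub (blkCell 4 0) (blkCell 5 0)) (blkCell 3 0))
    (.mul (blkCell 2 3) (blkCell 3 4)))))
  (.seq (vecLoop 1 (.add (blkCell 1 3) (.mul (.div (.sub (.mul (blkCell 6 0) (blkCell 4 0))
    (blkCell 0 0)) (blkCell 4 0)) (blkCell 2 3))))
    (.store (blkExp 0 0) (blkCell 6 0))))))))

/-- The row g = uᵀG is computed before G is overwritten, and Bu = y is already available, so both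
matrix updates are rank-one corrections costing O(d²). The new α waits in block 6 because the center
still needs the old one. -/
noncomputable def Store.stretched (M : Store) (d : ℕ) : Store :=
  let P := M.prepared d
  let a := M.blk 0 d
  let q := M.coordSq d
  let r := Real.sqrt q
  let b := EllipsoidUpdate.widen a r
  let a' := EllipsoidUpdate.shrink a r
  let g := fun i => ∑ j ∈ Finset.range d, M.coord d j * M.mat 1 j i
  (((((((P.setBlk 4 d r).setBlk 5 d b).setBlk 6 d a').setVec 5 d g).setMat 1 d
    fun i j => (M.mat 1 i j + (b / r - 1) / q * (M.coord d i * g j)) / b).setMat 0 d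
    fun i j => b * M.mat 0 i j + (r - b) / q * (M.diff i * M.coord d j)).setVec 1 d
    fun i => M.blk 1 i + (a' * r - a) / r * M.diff i).setBlk 0 d a'

section Stretch

open EllipsoidUpdate

variable {S d m f : ℕ} {M : Store} {σ : State}

theorem run_stretch (hd : 1 ≤ d) (hS : 100 * (d * d) ≤ S) (hα : 0 < M.blk 0 d)
    (hq : 1 < M.coordSq d) (h : At d m f (M.prepared d) σ) :
    Run S stretch σ (At d m f (M.stretched d)) (2000 * (d * d)) := by
  have hdd : d ≤ d * d := Nat.le_mul_self d
  set a := M.blk 0 d with ha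
  set q := M.coordSq d with hqdef
  set r := Real.sqrt q with hrdef
  have hr : 1 < r := by rw [hrdef, Real.lt_sqrt (by norm_num)]; simpa using hq
  have hr0 : r ≠ 0 := by linarith
  have hq0 : q ≠ 0 := by linarith
  have hb0 : widen a r ≠ 0 := by linarith [one_lt_widen hα hr]
  have hden : 1 + 4 * a * (1 - 1 / r) ≠ 0 := by
    have := one_sub_inv_pos hr
    positivity
  have hbdef : widen a r = 1 + a * (1 - 1 / r) := rfl
  have hadef : shrink a r = a / (1 + 4 * a * (1 - 1 / r)) := rfl
  have hSt : M.stretched d = (((((((((M.prepared d).setBlk 4 d r).setBlk 5 d (widen a r)).setBlk 6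
      d (shrink a r)).setVec 5 d fun i => ∑ j ∈ Finset.range d, M.coord d j * M.mat 1 j i).setMat 1
      d fun i j => (M.mat 1 i j + (widen a r / r - 1) / q * (M.coord d i *
        ∑ k ∈ Finset.range d, M.coord d k * M.mat 1 k j)) / widen a r).setMat 0 d
      fun i j => widen a r * M.mat 0 i j + (r - widen a r) / q * (M.diff i * M.coord d j)).setVec 1 d
      fun i => M.blk 1 i + (shrink a r * r - a) / r * M.diff i).setBlk 0 d (shrink a r)) := rfl
  rw [hSt]
  clear hSt
  generalize widen a r = b at *
  generalize shrink a r = a' at *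
  clear_value r q
  refine Run.mono (T := 200 + (200 + (200 + (_ + (_ + (_ + (_ + 200)))))))
    (Run.seq (Run.mono (run_storeBlk hd hS h (x := r) h.dim
       (.scalar (by norm_num) (by norm_num)) ?_) (fun σ' h' => h'.1) (by decide)) fun σ₁ h₁ =>
     Run.seq (Run.mono (run_storeBlk hd hS h₁ (x := b) h₁.dim
       (.scalar (by norm_num) (by norm_num)) ?_) (fun σ' h' => h'.1) (by decide)) fun σ₂ h₂ =>
     Run.seq (Run.mono (run_storeBlk hd hS h₂ (x := a') h₂.dim
       (.scalar (by norm_num) (by norm_num)) ?_) (fun σ' h' => h'.1) (by decide)) fun σ₃ h₃ =>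
     Run.seq (run_sumLoop hd hS h₃ (F₀ := fun _ => 0) (F := fun i j => M.coord d j * M.mat 1 j i)
       (by norm_num) ?_ ?_) fun σ₄ h₄ =>
     Run.seq (run_matLoop hd hS h₄ (by norm_num) (F := fun i j => (M.mat 1 i j +
       (b / r - 1) / q * (M.coord d i *
        ∑ k ∈ Finset.range d, M.coord d k * M.mat 1 k j)) / b) ?_) fun σ₅ h₅ =>
     Run.seq (run_matLoop hd hS h₅ (by norm_num) (F := fun i j => b * M.mat 0 i j +
       (r - b) / q * (M.diff i * M.coord d j)) ?_) fun σ₆ h₆ =>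
     Run.seq (run_vecLoop hd hS h₆ (F := fun i => M.blk 1 i + (a' * r - a) / r * M.diff i)
       (by norm_num) ?_) fun σ₇ h₇ =>
     Run.mono (run_storeBlk hd hS h₇ (x := a') h₇.dim
       (.scalar (by norm_num) (by norm_num)) ?_) (fun σ' h' => h'.1) (by decide)) ?_ ?_
  · refine ((h.blk hd hS h.dim (.scalar (by norm_num) (by norm_num))).sqrt ?_).congr ?_
    · simp [Store.prepared, Store.setBlk, ← hqdef]; linarith
    · simp [Store.prepared, Store.setBlk, ← hqdef, hrdef]
  · refine ((Val.const 1).add ((h₁.blk hd hS h₁.dim (.scalar (by norm_num) (by norm_num))).mul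
      ((Val.const 1).sub ((Val.const 1).div
        (h₁.blk hd hS h₁.dim (.scalar (by norm_num) (by norm_num))) ?_)))).congr ?_
    · simpa [Store.prepared, Store.setBlk, Store.setVec] using hr0
    · simp [Store.prepared, Store.setBlk, Store.setVec, ← ha, hbdef]
  · refine ((h₂.blk hd hS h₂.dim (.scalar (by norm_num) (by norm_num))).div ((Val.const 1).add
      (((Val.const 4).mul (h₂.blk hd hS h₂.dim (.scalar (by norm_num) (by norm_num)))).mul
      ((Val.const 1).sub ((Val.const 1).div
        (h₂.blk hd hS h₂.dim (.scalar (by norm_num) (by norm_num))) ?_)))) ?_).congr ?_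
    · simpa [Store.prepared, Store.setBlk, Store.setVec] using hr0
    · simpa [Store.prepared, Store.setBlk, Store.setVec, ← ha] using hden
    · simp [Store.prepared, Store.setBlk, Store.setVec, ← ha, hadef]
  · intro i hi G σ hσ h3
    exact (Val.const 0).congr (by simp)
  · intro i hi j hj G x σ hσ h3 h4
    refine ((hσ.blk hd hS h4 (.vec (by norm_num) hj)).mul
      (hσ.mat hS h4 h3 ⟨by norm_num, hj, hi⟩)).congr ?_
    simp [Store.prepared, Store.setVec, Store.setBlk, hj, hj.ne]
  · intro i hi j hj σ hσ h3 h4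
    refine (((hσ.mat hS h3 h4 ⟨by norm_num, hi, hj⟩).add
      (((((hσ.blk hd hS hσ.dim (.scalar (by norm_num) (by norm_num))).div
      (hσ.blk hd hS hσ.dim (.scalar (by norm_num) (by norm_num))) ?_).sub (Val.const 1)).div
      (hσ.blk hd hS hσ.dim (.scalar (by norm_num) (by norm_num))) ?_).mul
      ((hσ.blk hd hS h3 (.vec (by norm_num) hi)).mul
      (hσ.blk hd hS h4 (.vec (by norm_num) hj))))).div
      (hσ.blk hd hS hσ.dim (.scalar (by norm_num) (by norm_num))) ?_).congr ?_
    · simpa [Store.setMat, Store.setRow, Store.prepared, Store.setBlk, Store.setVec] using hr0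
    · simpa [Store.setMat, Store.setRow, Store.prepared, Store.setBlk, Store.setVec, ← hqdef]
        using hq0
    · simpa [Store.setMat, Store.setRow, Store.prepared, Store.setBlk, Store.setVec] using hb0
    · simp [Store.setMat, Store.setRow, Store.prepared, Store.setBlk, Store.setVec, hi, hj, hi.ne,
        ← hqdef]
  · intro i hi j hj σ hσ h3 h4
    refine (((hσ.blk hd hS hσ.dim (.scalar (by norm_num) (by norm_num))).mul
      (hσ.mat hS h3 h4 ⟨by norm_num, hi, hj⟩)).add
      ((((hσ.blk hd hS hσ.dim (.scalar (by norm_num) (by norm_num))).sub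
      (hσ.blk hd hS hσ.dim (.scalar (by norm_num) (by norm_num)))).div
      (hσ.blk hd hS hσ.dim (.scalar (by norm_num) (by norm_num))) ?_).mul
      ((hσ.blk hd hS h3 (.vec (by norm_num) hi)).mul
      (hσ.blk hd hS h4 (.vec (by norm_num) hj))))).congr ?_
    · simpa [Store.setMat, Store.setRow, Store.prepared, Store.setBlk, Store.setVec, ← hqdef]
        using hq0
    · simp [Store.setMat, Store.setRow, Store.prepared, Store.setBlk, Store.setVec, hi, hj, hi.ne,
        hj.ne, ← hqdef]
  · intro i hi σ hσ h3
    refine ((hσ.blk hd hS h3 (.vec (by norm_num) hi)).add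
      (((((hσ.blk hd hS hσ.dim (.scalar (by norm_num) (by norm_num))).mul
      (hσ.blk hd hS hσ.dim (.scalar (by norm_num) (by norm_num)))).sub
      (hσ.blk hd hS hσ.dim (.scalar (by norm_num) (by norm_num)))).div
      (hσ.blk hd hS hσ.dim (.scalar (by norm_num) (by norm_num))) ?_).mul
      (hσ.blk hd hS h3 (.vec (by norm_num) hi)))).congr ?_
    · simpa [Store.setMat, Store.setRow, Store.prepared, Store.setBlk, Store.setVec] using hr0
    · simp [Store.setMat, Store.prepared, Store.setBlk, Store.setVec, hi, hi.ne, ← ha]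
  · refine (h₇.blk hd hS h₇.dim (.scalar (by norm_num) (by norm_num))).congr ?_
    simp [Store.setMat, Store.prepared, Store.setBlk, Store.setVec]
  · intro σ' h'
    refine h'.congr (fun k i _ => ?_) (fun k i j _ => ?_)
    · simp [Store.setMat, Store.setBlk, Store.setVec]
    · simp [Store.setMat, Store.setBlk, Store.setVec]
  · simp only [RExp.cost, blkCell, matCell, blkExp, matExp, IExp.cost]
    nlinarith

end Stretch

end RealRAM

/-! ### Correctness of the update program. -/

namespace RealRAM

open EllipsoidUpdate Matrix

def Store.center (M : Store) (d : ℕ) : EuclideanSpace ℝ (Fin d) :=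
  WithLp.toLp 2 fun i => M.blk 1 i

def Store.axes (M : Store) (d m : ℕ) : Matrix (Fin d) (Fin m) ℝ :=
  Matrix.of fun i j => M.mat 0 i j

def Store.coords (M : Store) (d m : ℕ) : Matrix (Fin m) (Fin d) ℝ :=
  Matrix.of fun i j => M.mat 1 i j

/-- The memory `M` describes a rounding of the points `Z` with `m` axes. -/
structure Store.Holds (M : Store) (d m : ℕ) (Z : Set (EuclideanSpace ℝ (Fin d))) : Prop where
  rounding : Rounding Z (M.center d) (M.axes d m) (M.coords d m) (M.blk 0 d)
  axes_zero : ∀ i < d, ∀ j < d, m ≤ j → M.mat 0 i j = 0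
  coords_zero : ∀ i < d, ∀ j < d, m ≤ i → M.mat 1 i j = 0

/-- Links the loops, which always run to d, with products over the m axes; the unused columns and
rows are kept at zero. -/
theorem sum_range_eq_sum_fin {m d : ℕ} (hm : m ≤ d) {F : ℕ → ℝ}
    (h : ∀ j < d, m ≤ j → F j = 0) : ∑ j ∈ Finset.range d, F j = ∑ j : Fin m, F j := by
  rw [← Finset.sum_range, eq_comm]
  refine Finset.sum_subset (Finset.range_subset_range.2 hm) fun j hj hj' => ?_
  simp only [Finset.mem_range, not_lt] at hj hj'
  exact h j hj hj'

namespace Store.Holds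

variable {M : Store} {d m : ℕ} {Z : Set (EuclideanSpace ℝ (Fin d))}
  {z : EuclideanSpace ℝ (Fin d)}

theorem coord_eq (hz : ∀ i : Fin d, z.ofLp i = M.blk 0 i) (i : Fin m) :
    (M.coords d m *ᵥ (z - M.center d).ofLp) i = M.coord d i := by
  simp [mulVec, dotProduct, Store.coord, Store.coords, Store.center, Finset.sum_range, Store.diff,
    hz]

theorem coord_zero (h : M.Holds d m Z) {i : ℕ} (hi : i < d) (hmi : m ≤ i) : M.coord d i = 0 := by
  refine Finset.sum_eq_zero fun j hj => ?_
  rw [h.coords_zero i hi j (Finset.mem_range.1 hj) hmi, zero_mul]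

theorem diff_eq (hz : ∀ i : Fin d, z.ofLp i = M.blk 0 i) (i : Fin d) :
    (z - M.center d).ofLp i = M.diff i := by
  simp [Store.center, Store.diff, hz]

theorem resid_eq (h : M.Holds d m Z) (hz : ∀ i : Fin d, z.ofLp i = M.blk 0 i) (i : Fin d) :
    ((z - M.center d).ofLp - M.axes d m *ᵥ (M.coords d m *ᵥ (z - M.center d).ofLp)) i =
      M.resid d i := by
  rw [Pi.sub_apply, diff_eq hz, Store.resid, sum_range_eq_sum_fin h.rounding.rank_le
    (fun j hj hmj => by rw [h.coord_zero hj hmj]; simp)]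
  simp only [zero_sub, Finset.sum_neg_distrib]
  rw [sub_eq_add_neg]
  congr 2
  change ∑ j, M.axes d m i j * (M.coords d m *ᵥ (z - M.center d).ofLp) j = _
  exact Finset.sum_congr rfl fun j _ => by rw [coord_eq hz j]; rfl

theorem coordSq_eq (h : M.Holds d m Z) (hz : ∀ i : Fin d, z.ofLp i = M.blk 0 i) :
    (M.coords d m *ᵥ (z - M.center d).ofLp) ⬝ᵥ (M.coords d m *ᵥ (z - M.center d).ofLp) =
      M.coordSq d := by
  rw [Store.coordSq, sum_range_eq_sum_fin h.rounding.rank_le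
    (fun j hj hmj => by rw [h.coord_zero hj hmj]; simp)]
  exact Finset.sum_congr rfl fun j _ => by rw [coord_eq hz j]

theorem residSq_eq (h : M.Holds d m Z) (hz : ∀ i : Fin d, z.ofLp i = M.blk 0 i) :
    M.residSq d = ((z - M.center d).ofLp -
      M.axes d m *ᵥ (M.coords d m *ᵥ (z - M.center d).ofLp)) ⬝ᵥ ((z - M.center d).ofLp -
      M.axes d m *ᵥ (M.coords d m *ᵥ (z - M.center d).ofLp)) := by
  rw [Store.residSq, Finset.sum_range]
  exact Finset.sum_congr rfl fun j _ => by rw [h.resid_eq hz j]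

/-- Room for another axis needs no test: the enlarged rounding has m + 1 independent columns in
dimension d. -/
theorem insert_grown (h : M.Holds d m Z) (hz : ∀ i : Fin d, z.ofLp i = M.blk 0 i)
    (hZ : ∀ z' ∈ insert z Z, ∃ k : Fin d → ℤ, ∀ i, z'.ofLp i = k i) (hs : M.residSq d ≠ 0) :
    m < d ∧ (M.grown d m).Holds d (m + 1) (insert z Z) := by
  have key := h.rounding.insert_append hZ rfl rfl (h.residSq_eq hz) hs
  have hmd : m < d := key.rank_le
  refine ⟨hmd, ?_, ?_, ?_⟩
  · convert key using 1
    · ext i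
      simp [Store.center, Store.grown, Store.setVec, hz, Store.diff]
    · ext i j
      refine Fin.lastCases ?_ (fun j => ?_) j
      · rw [appendCol_last, diff_eq hz]
        simp [Store.axes, Store.grown, Store.setVec, Store.setCol, Store.setBlk]
      · rw [appendCol_castSucc]
        simp [Store.axes, Store.grown, Store.setVec, Store.setCol, Store.setBlk, Store.setMat,
          j.2.ne]
    · ext i j
      refine Fin.lastCases ?_ (fun i => ?_) i
      · rw [appendRow_last, Pi.smul_apply, h.resid_eq hz]
        simp [Store.coords, Store.grown, Store.setVec, Store.setCol, Store.setBlk, Store.setMat,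
          Store.setRow]
        ring
      · rw [appendRow_castSucc, of_apply, h.resid_eq hz, coord_eq hz]
        have hi : (i : ℕ) < d := i.2.trans hmd
        simp [Store.coords, Store.grown, Store.setVec, Store.setCol, Store.setBlk, Store.setMat,
          Store.setRow, i.2.ne, hi]
    · simp [Store.grown, Store.setVec, Store.setBlk]
  · intro i hi j hj hmj
    have : j ≠ m := by omega
    simp [Store.grown, Store.setVec, Store.setCol, Store.setBlk, Store.setMat, this, hi,
      h.axes_zero i hi j hj (by omega)]
  · intro i hi j hj hmi
    have : i ≠ m := by omega
    simp [Store.grown, Store.setVec, Store.setCol, Store.setBlk, Store.setMat, Store.setRow, this,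
      hi, h.coords_zero i hi j hj (by omega), h.coord_zero hi (by omega)]

theorem axes_mulVec (h : M.Holds d m Z) (hz : ∀ i : Fin d, z.ofLp i = M.blk 0 i)
    (hs : M.residSq d ≤ 0) :
    (z - M.center d).ofLp = M.axes d m *ᵥ (M.coords d m *ᵥ (z - M.center d).ofLp) := by
  rw [h.residSq_eq hz] at hs
  have h0 := le_antisymm hs (Finset.sum_nonneg fun i _ => mul_self_nonneg _)
  exact sub_eq_zero.1 (dotProduct_self_eq_zero.1 h0)

theorem insert_stretched (h : M.Holds d m Z) (hz : ∀ i : Fin d, z.ofLp i = M.blk 0 i)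
    (hs : M.residSq d ≤ 0) (hq : 1 < M.coordSq d) :
    (M.stretched d).Holds d m (insert z Z) := by
  have hr : 1 < Real.sqrt (M.coordSq d) := by rw [Real.lt_sqrt (by norm_num)]; simpa using hq
  have hr2 : Real.sqrt (M.coordSq d) ^ 2 = M.coordSq d := Real.sq_sqrt (by linarith)
  have hu := h.axes_mulVec hz hs
  have key := h.rounding.insert_stretch hu hr (by rw [h.coordSq_eq hz, hr2])
  have hui := coord_eq (m := m) hz
  have hBu : ∀ i : Fin d, ∑ k : Fin m, M.mat 0 i k * M.coord d k = M.diff i := by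
    intro i
    rw [← diff_eq hz, hu]
    exact Finset.sum_congr rfl fun k _ => by rw [← hui]; rfl
  generalize M.coords d m *ᵥ (z - M.center d).ofLp = u at key hui
  have hmd := h.rounding.rank_le
  refine ⟨?_, ?_, ?_⟩
  · convert key using 1
    · ext i
      simp [Store.center, Store.stretched, Store.setVec, Store.setBlk, hz, Store.diff, shift]
    · ext i j
      rw [Matrix.mul_apply]
      simp only [stretchMatrix, Matrix.add_apply, Matrix.smul_apply, smul_eq_mul, mul_add,
        Finset.sum_add_distrib, one_apply, vecMulVec_apply, hui, hr2]
      have e : ∀ (x y : ℝ), ∑ k : Fin m, M.axes d m i k * (x * (M.coord d k * y)) =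
          x * (M.diff i * y) := by
        intro x y
        rw [← hBu, Finset.sum_mul, Finset.mul_sum]
        exact Finset.sum_congr rfl fun k _ => by simp only [Store.axes, of_apply]; ring
      rw [e]
      simp [Store.axes, Store.stretched, Store.setVec, Store.setBlk, Store.setMat, mul_comm]
    · ext i j
      have hi : (i : ℕ) < d := i.2.trans_le hmd
      rw [unstretchMatrix, Matrix.smul_mul, Matrix.add_mul, Matrix.one_mul, Matrix.smul_mul,
        Matrix.smul_apply, Matrix.add_apply, Matrix.smul_apply, Matrix.mul_apply]
      simp only [vecMulVec_apply, hui, hr2, smul_eq_mul]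
      have e : ∑ k : Fin m, M.coord d i * M.coord d k * M.coords d m k j =
          M.coord d i * ∑ k ∈ Finset.range d, M.coord d k * M.mat 1 k j := by
        rw [sum_range_eq_sum_fin hmd (fun k hk hmk => by rw [h.coord_zero hk hmk, zero_mul]),
          Finset.mul_sum]
        exact Finset.sum_congr rfl fun k _ => by simp only [Store.coords, of_apply]; ring
      rw [e]
      simp [Store.coords, Store.stretched, Store.setVec, Store.setBlk, Store.setMat, hi]
      ring
    · simp [Store.stretched, Store.setBlk]
  · intro i hi j hj hmj
    simp [Store.stretched, Store.setVec, Store.setBlk, Store.setMat, hi, h.axes_zero i hi j hj hmj,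
      h.coord_zero hj hmj]
  · intro i hi j hj hmi
    simp [Store.stretched, Store.setVec, Store.setBlk, Store.setMat, hi,
      h.coords_zero i hi j hj hmi, h.coord_zero hi hmi]

theorem insert_prepared (h : M.Holds d m Z) (hz : ∀ i : Fin d, z.ofLp i = M.blk 0 i)
    (hs : M.residSq d ≤ 0) (hq : M.coordSq d ≤ 1) :
    (M.prepared d).Holds d m (insert z Z) := by
  have hu := h.axes_mulVec hz hs
  have key := h.rounding.insert_of_mem (z := z)
    (x := WithLp.toLp 2 (M.coords d m *ᵥ (z - M.center d).ofLp)) (by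
      rw [← sq_le_one_iff₀ (norm_nonneg _), ← dotProduct_self_eq_norm_sq, h.coordSq_eq hz]
      exact hq) (by
      rw [toEuclideanLin_eq, ← hu]; simp)
  exact ⟨by simpa [Store.prepared, Store.setVec, Store.setBlk, Store.center, Store.axes,
    Store.coords] using key, h.axes_zero, h.coords_zero⟩

end Store.Holds

/-- Start with the first point. -/
def first : Cmd :=
  .seq (vecLoop 1 (blkCell 0 3)) (.seq (.store (blkExp 0 0) (.const 1)) (.assign 2 (.lit 1)))

/-- Process the arriving point. -/
def update : Cmd :=
  .branch (.idxLT (.var 2) (.lit 1)) first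
    (.seq prepare (.branch (.not (.realLE (blkCell 2 0) (.const 0))) grow
      (.branch (.not (.realLE (blkCell 3 0) (.const 1))) stretch .skip)))

section Update

variable {S d m : ℕ} {M : Store} {σ : State} {Z : Set (EuclideanSpace ℝ (Fin d))}
  {z : EuclideanSpace ℝ (Fin d)}

theorem Run.branch {b : BExp} {p q : Cmd} {Q : State → Prop} {T : ℕ} (hb : b.Safe S σ)
    (hp : b.eval σ → Run S p σ Q T) (hq : ¬ b.eval σ → Run S q σ Q T) :
    Run S (.branch b p q) σ Q (b.cost + 1 + T) := by
  by_cases h : b.eval σ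
  · obtain ⟨σ', T', l, e, q⟩ := hp h
    exact ⟨σ', _, by omega, .branchTrue hb h e, q⟩
  · obtain ⟨σ', T', l, e, q⟩ := hq h
    exact ⟨σ', _, by omega, .branchFalse hb h e, q⟩

theorem At.receive {f : ℕ} (h : At d m f M σ) (z : EuclideanSpace ℝ (Fin d)) :
    At d m f (M.setVec 0 d fun i => if hi : i < d then z.ofLp ⟨i, hi⟩ else 0)
      (StreamAlgorithm.receive z σ) := by
  refine ⟨h.dim, h.rank, h.flag, ⟨fun k i hv => ?_, fun k i j hv => ?_⟩⟩
  · have e := h.rep.blk k i hv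
    obtain ⟨h1, h2, h3⟩ := hv
    by_cases hk : k = 0 ∧ i < d
    · obtain ⟨rfl, hi⟩ := hk
      simp [StreamAlgorithm.receive, Store.setVec, blkAddr, blkOffset, hi]
    · have : ¬ blkAddr d k i < d := by
        unfold blkAddr
        rcases Nat.eq_zero_or_pos k with rfl | hk'
        · omega
        · have := Nat.mul_le_mul_right (d + 1) hk'
          omega
      simp only [StreamAlgorithm.receive, dif_neg this, Store.setVec, if_neg hk, e]
  · have : ¬ matAddr d k i j < d := by unfold matAddr; omega
    simp only [StreamAlgorithm.receive, dif_neg this, Store.setVec]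
    exact h.rep.mat k i j hv

theorem Store.receive_blk (M : Store) (z : EuclideanSpace ℝ (Fin d)) (i : Fin d) :
    z.ofLp i = (M.setVec 0 d fun i => if hi : i < d then z.ofLp ⟨i, hi⟩ else 0).blk 0 i := by
  simp [Store.setVec]

theorem Store.Holds.receive (h : M.Holds d m Z) (f : ℕ → ℝ) :
    (M.setVec 0 d f).Holds d m Z :=
  ⟨by simpa [Store.setVec, Store.center, Store.axes, Store.coords] using h.rounding, h.axes_zero,
    h.coords_zero⟩

/-- The state `σ` describes a rounding of the points `Z`. -/
def Describes (d : ℕ) (Z : Set (EuclideanSpace ℝ (Fin d))) (σ : State) : Prop :=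
  ∃ m M, At d m 1 M σ ∧ M.Holds d m Z

theorem run_update (hd : 1 ≤ d) (hS : 100 * (d * d) ≤ S)
    (hZ : ∀ z' ∈ insert z Z, ∃ k : Fin d → ℤ, ∀ i, z'.ofLp i = k i) (h : Describes d Z σ) :
    Run S update (StreamAlgorithm.receive z σ) (Describes d (insert z Z)) (5000 * (d * d)) := by
  have hdd : d ≤ d * d := Nat.le_mul_self d
  obtain ⟨m, M₀, hA, hM⟩ := h
  replace hA := hA.receive z
  have hz := M₀.receive_blk z
  replace hM := hM.receive fun i => if hi : i < d then z.ofLp ⟨i, hi⟩ else 0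
  generalize M₀.setVec 0 d (fun i => if hi : i < d then z.ofLp ⟨i, hi⟩ else 0) = M at *
  refine Run.mono (T := 3 + 1 + (2000 * (d * d) + (17 + 1 + (17 + 1 + 2000 * (d * d)))))
    (Run.branch ?_ (fun hb => ?_) fun _ => ?_) (fun _ h => h) (by omega)
  · simp only [BExp.Safe, IExp.Safe, hA.flag]; omega
  · simp [BExp.eval, IExp.eval, hA.flag] at hb
  · refine (run_prepare hd hS hA).seq fun σ₁ h₁ => ?_
    have hs := h₁.blk hd hS h₁.dim (.scalar (k := 2) (by norm_num) (by norm_num))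
    have hq := h₁.blk hd hS h₁.dim (.scalar (k := 3) (by norm_num) (by norm_num))
    have es : (M.prepared d).blk 2 d = M.residSq d := by simp [Store.prepared, Store.setBlk]
    have eq : (M.prepared d).blk 3 d = M.coordSq d := by simp [Store.prepared, Store.setBlk]
    rw [es] at hs
    rw [eq] at hq
    refine Run.mono (T := 17 + 1 + (17 + 1 + 2000 * (d * d)))
      (Run.branch ⟨hs.1, trivial⟩ (fun hb => ?_) fun hb => ?_) (fun _ h => h) le_rfl
    · simp only [BExp.eval, RExp.eval, hs.2, Nat.cast_zero] at hb
      obtain ⟨hmd, hG⟩ := hM.insert_grown hz hZ (fun h0 => hb h0.le)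
      exact (run_grow hd hS hmd hM.rounding.pos (fun h0 => hb h0.le) h₁).mono
        (fun σ' h' => ⟨_, _, h', hG⟩) (by omega)
    · simp only [BExp.eval, RExp.eval, hs.2, Nat.cast_zero, not_not] at hb
      refine Run.branch ⟨hq.1, trivial⟩ (fun hb' => ?_) fun hb' => ?_
      · simp only [BExp.eval, RExp.eval, hq.2, Nat.cast_one, not_le] at hb'
        exact (run_stretch hd hS hM.rounding.pos hb' h₁).mono
          (fun σ' h' => ⟨_, _, h', hM.insert_stretched hz hb hb'⟩) le_rfl
      · simp only [BExp.eval, RExp.eval, hq.2, Nat.cast_one, not_not] at hb'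
        exact ⟨σ₁, 1, by nlinarith, .skip σ₁, _, _, h₁, hM.insert_prepared hz hb hb'⟩

theorem at_start (d : ℕ) :
    At d 0 0 ⟨fun _ _ => 0, fun _ _ _ => 0⟩ (StreamAlgorithm.start d) :=
  ⟨rfl, rfl, rfl, ⟨fun _ _ _ => rfl, fun _ _ _ _ => rfl⟩⟩

theorem run_update_start (hd : 1 ≤ d) (hS : 100 * (d * d) ≤ S) :
    Run S update (StreamAlgorithm.receive z (StreamAlgorithm.start d)) (Describes d {z})
      (5000 * (d * d)) := by
  have hdd : d ≤ d * d := Nat.le_mul_self d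
  have hA := (at_start d).receive z
  have hz := Store.receive_blk ⟨fun _ _ => 0, fun _ _ _ => 0⟩ z
  have hmat : (Store.setVec ⟨fun _ _ => 0, fun _ _ _ => 0⟩ 0 d
    (fun i => if hi : i < d then z.ofLp ⟨i, hi⟩ else 0)).mat = fun _ _ _ => 0 := rfl
  generalize Store.setVec ⟨fun _ _ => 0, fun _ _ _ => 0⟩ 0 d
    (fun i => if hi : i < d then z.ofLp ⟨i, hi⟩ else 0) = M at *
  refine Run.mono (T := 3 + 1 + (d * ((blkCell 0 3).cost + 14 + 8) + 8 + (100 + 2)))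
    (Run.branch ?_ (fun _ => ?_) fun hb => ?_) (fun _ h => h) ?_
  · simp only [BExp.Safe, IExp.Safe, hA.flag]; omega
  · refine (run_vecLoop hd hS hA (F := fun i => M.blk 0 i) (by norm_num)
      (fun i hi σ hσ h3 => ?_)).seq fun σ₁ h₁ => ?_
    · refine (hσ.blk hd hS h3 (.vec (by norm_num) hi)).congr ?_
      simp [Store.setVec]
    · refine Run.seq (Run.mono (run_storeBlk hd hS h₁ (k := 0) h₁.dim
        (.scalar (by norm_num) (by norm_num)) (Val.const 1)) (fun _ h => h.1) (by decide))
        fun σ₂ h₂ => ?_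
      refine ⟨_, _, le_rfl, Exec.assign 2 (.lit 1) σ₂ (by simp only [IExp.Safe]; omega), 0, _,
        ⟨?_, ?_, ?_, h₂.rep.blk, h₂.rep.mat⟩, ?_, ?_, ?_⟩
      · simpa using h₂.dim
      · simpa using h₂.rank
      · simp [IExp.eval]
      · convert Rounding.singleton z using 1
        · ext i
          simp [Store.center, Store.setVec, Store.setBlk, hz]
        · ext i j; exact j.elim0
        · ext i; exact i.elim0
        · simp [Store.setBlk]
      · intro i _ j _ _
        simp [Store.setVec, Store.setBlk, hmat]
      · intro i _ j _ _
        simp [Store.setVec, Store.setBlk, hmat]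
  · simp [BExp.eval, IExp.eval, hA.flag] at hb
  · simp only [RExp.cost, blkCell, blkExp, IExp.cost]
    nlinarith

end Update

end RealRAM

/-! ### From the machine states to the theorem. -/

open RealRAM

/-- Zero columns do not change the image: dropping coordinates does not increase the norm, and
padding with zeros preserves it. -/
theorem ellipsoid_eq_image {d m : ℕ} (hm : m ≤ d) {A : Matrix (Fin d) (Fin d) ℝ}
    {B : Matrix (Fin d) (Fin m) ℝ} (hA : ∀ i (j : Fin m), A i (Fin.castLE hm j) = B i j)
    (h0 : ∀ i (j : Fin d), m ≤ j → A i j = 0) :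
    ellipsoid A = Matrix.toEuclideanLin B '' Metric.closedBall 0 1 := by
  obtain ⟨k, rfl⟩ := Nat.exists_eq_add_of_le hm
  have hcast : ∀ j : Fin m, Fin.castLE hm j = Fin.castAdd k j := fun _ => rfl
  simp only [hcast] at hA
  have hAx : ∀ x : EuclideanSpace ℝ (Fin (m + k)), Matrix.toEuclideanLin A x =
      Matrix.toEuclideanLin B (WithLp.toLp 2 fun j => x.ofLp (Fin.castAdd k j)) := by
    intro x
    ext i
    simp only [EllipsoidUpdate.toEuclideanLin_eq, Matrix.mulVec, dotProduct]
    rw [Fin.sum_univ_add]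
    simp [hA, h0]
  unfold ellipsoid
  ext p
  simp only [Set.mem_image, mem_closedBall_zero_iff]
  constructor
  · rintro ⟨x, hx, rfl⟩
    refine ⟨_, ?_, (hAx x).symm⟩
    rw [← sq_le_one_iff₀ (norm_nonneg _)] at hx ⊢
    refine le_trans ?_ hx
    rw [EuclideanSpace.norm_sq_eq, EuclideanSpace.norm_sq_eq, Fin.sum_univ_add]
    exact le_add_of_nonneg_right (Finset.sum_nonneg fun _ _ => sq_nonneg _)
  · rintro ⟨x, hx, rfl⟩
    refine ⟨WithLp.toLp 2 (Fin.append x.ofLp 0), ?_, ?_⟩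
    · rw [← sq_le_one_iff₀ (norm_nonneg _)] at hx ⊢
      refine le_trans (le_of_eq ?_) hx
      rw [EuclideanSpace.norm_sq_eq, EuclideanSpace.norm_sq_eq, Fin.sum_univ_add]
      simp
    · rw [hAx]; simp

theorem firstPoints_succ {d n : ℕ} (z : Fin n → EuclideanSpace ℝ (Fin d)) (i : Fin n) :
    firstPoints z (i + 1) = insert (z i) (firstPoints z i) := by
  ext x
  simp only [firstPoints, Set.mem_ofPred_eq, Set.mem_insert_iff]
  constructor
  · rintro ⟨j, hj, rfl⟩
    rcases Nat.lt_succ_iff_lt_or_eq.1 hj with h | h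
    · exact Or.inr ⟨j, h, rfl⟩
    · exact Or.inl (congrArg z (Fin.ext h))
  · rintro (rfl | ⟨j, hj, rfl⟩)
    · exact ⟨i, Nat.lt_succ_self _, rfl⟩
    · exact ⟨j, by omega, rfl⟩

theorem firstPoints_zero {d n : ℕ} (z : Fin n → EuclideanSpace ℝ (Fin d)) :
    firstPoints z 0 = ∅ := by
  ext x
  simp [firstPoints]

namespace RealRAM

/-- The streaming algorithm; the initial state of the machine needs no preparation. -/
def roundingAlgorithm : StreamAlgorithm where
  init := .skip
  update := update

theorem exists_isRun {d n S : ℕ} (hd : 1 ≤ d) (hS : 100 * (d * d) ≤ S)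
    (z : Fin n → EuclideanSpace ℝ (Fin d))
    (hz : ∀ i, ∃ k : Fin d → ℤ, ∀ j, (z i).ofLp j = k j) :
    ∃ (s : ℕ → State) (τ : ℕ → ℕ), roundingAlgorithm.IsRun S z s τ ∧ τ 0 = 1 ∧
      (∀ t < n, τ (t + 1) ≤ 5000 * (d * d)) ∧
      ∀ t, 1 ≤ t → t ≤ n → Describes d (firstPoints z t) (s t) := by
  have hstep : ∀ (i : ℕ) (σ : State), ∃ p : State × ℕ, ∀ hi : i < n,
      (i = 0 → σ = StreamAlgorithm.start d) →
      (1 ≤ i → Describes d (firstPoints z i) σ) →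
      Exec S update (StreamAlgorithm.receive (z ⟨i, hi⟩) σ) p.1 p.2 ∧ p.2 ≤ 5000 * (d * d) ∧
        Describes d (firstPoints z (i + 1)) p.1 := by
    intro i σ
    by_cases h : i < n ∧ (i = 0 → σ = StreamAlgorithm.start d) ∧
        (1 ≤ i → Describes d (firstPoints z i) σ)
    · obtain ⟨hi, h0, h1⟩ := h
      have hpts := firstPoints_succ z ⟨i, hi⟩
      have : Run S update (StreamAlgorithm.receive (z ⟨i, hi⟩) σ)
          (Describes d (firstPoints z (i + 1))) (5000 * (d * d)) := by
        rcases Nat.eq_zero_or_pos i with rfl | hpos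
        · rw [h0 rfl, hpts, firstPoints_zero, insert_empty_eq]
          exact run_update_start hd hS
        · rw [hpts]
          refine run_update hd hS ?_ (h1 hpos)
          rintro _ (rfl | ⟨j, -, rfl⟩)
          · exact hz _
          · exact hz _
      obtain ⟨σ', T, hT, he, hQ⟩ := this
      exact ⟨(σ', T), fun _ _ _ => ⟨he, hT, hQ⟩⟩
    · exact ⟨(σ, 0), fun hi h0 h1 => absurd ⟨hi, h0, h1⟩ h⟩
  choose F hF using hstep
  let s : ℕ → State := fun t => Nat.rec (StreamAlgorithm.start d) (fun i σ => (F i σ).1) t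
  let τ : ℕ → ℕ := fun t => Nat.casesOn t 1 fun i => (F i (s i)).2
  have hs0 : ∀ i, i = 0 → s i = StreamAlgorithm.start d := by rintro _ rfl; rfl
  have hs : ∀ t, t ≤ n → 1 ≤ t → Describes d (firstPoints z t) (s t) := by
    intro t
    induction t with
    | zero => intro _ h; omega
    | succ t ih =>
      intro ht _
      exact (hF t (s t) (by omega) (hs0 t) (ih (by omega))).2.2
  have hstep' := fun i (hi : i < n) => hF i (s i) hi (hs0 i) (hs i hi.le)
  refine ⟨s, τ, ⟨?_, .skip _, fun i => (hstep' i i.2).1⟩, rfl,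
    fun t ht => (hstep' t ht).2.1, fun t h1 h2 => hs t h2 h1⟩
  nlinarith

end RealRAM

theorem theorem3 :
    ∃ (P : StreamAlgorithm) (C k : ℕ),
      ∀ (d n N : ℕ) (_ : 1 ≤ d) (z : Fin n → EuclideanSpace ℝ (Fin d))
        (_ : ∀ (i : Fin n) (j : Fin d), ∃ m : ℤ, -(N : ℤ) ≤ m ∧ m ≤ (N : ℤ) ∧ z i j = (m : ℝ)),
        ∃ (s : ℕ → RealRAM.State) (τ : ℕ → ℕ),
          -- storage: `C * d ^ 2` real cells
          P.IsRun (C * d ^ 2) z s τ ∧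
          ∀ t : ℕ, 1 ≤ t → t ≤ n →
            let α : ℝ := StreamAlgorithm.scaling d (s t)
            let c : EuclideanSpace ℝ (Fin d) := StreamAlgorithm.center d (s t)
            let E : Set (EuclideanSpace ℝ (Fin d)) := ellipsoid (StreamAlgorithm.shape d (s t))
            let Z : Set (EuclideanSpace ℝ (Fin d)) := convexHull ℝ (firstPoints z t)
            0 < α ∧ α ≤ 1 ∧
            c +ᵥ α • E ⊆ Z ∧ Z ⊆ c +ᵥ E ∧
            (2 ≤ d * N → 1 ≤ affineDim z t →
              1 / α ≤ C * (affineDim z t * Real.log ((d : ℝ) * (N : ℝ)))) ∧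
            (affineDim z t = 0 → α = 1) ∧
            -- running time of the first `t` steps
            ((∑ i ∈ Finset.range (t + 1), τ i : ℕ) : ℝ) ≤
              C * ((t : ℝ) * (d : ℝ) ^ 2 * (1 + Real.log d) ^ k) := by
  -- 6000 covers the 100d² cells, the factor 80 in the approximation bound and 5000d² steps per
  -- point plus the initialization. The exponent of the logarithm is 0.
  refine ⟨roundingAlgorithm, 6000, 0, fun d n N hd z hz => ?_⟩
  have hint : ∀ i, ∃ k : Fin d → ℤ, ∀ j, (z i).ofLp j = k j := fun i => by
    choose k hk using hz i
    exact ⟨k, fun j => (hk j).2.2⟩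
  obtain ⟨s, τ, hrun, hτ0, hτ, hs⟩ := exists_isRun (S := 6000 * d ^ 2) hd (by nlinarith) z hint
  refine ⟨s, τ, hrun, fun t ht1 htn => ?_⟩
  obtain ⟨m, M, hA, hM⟩ := hs t ht1 htn
  have hR := hM.rounding
  have hmd := hR.rank_le
  have hα : StreamAlgorithm.scaling d (s t) = M.blk 0 d := by
    rw [← hA.rep.blk 0 d (.scalar (by norm_num) (by norm_num))]
    simp [StreamAlgorithm.scaling, blkAddr, blkOffset]
  have hc : StreamAlgorithm.center d (s t) = M.center d := by
    ext i
    simp only [StreamAlgorithm.center, Store.center]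
    rw [← hA.rep.blk 1 i (.vec (by norm_num) i.2)]
    simp [blkAddr, blkOffset]
  have hshape : ∀ i j : Fin d, StreamAlgorithm.shape d (s t) i j = M.mat 0 i j := by
    intro i j
    rw [← hA.rep.mat 0 i j ⟨by norm_num, i.2, j.2⟩]
    simp [StreamAlgorithm.shape, matAddr]
  have hE : ellipsoid (StreamAlgorithm.shape d (s t)) =
      Matrix.toEuclideanLin (M.axes d m) '' Metric.closedBall 0 1 :=
    ellipsoid_eq_image hmd (fun i j => hshape i _)
      (fun i j hj => (hshape i j).trans (hM.axes_zero i i.2 j j.2 hj))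
  have hdim : affineDim z t = m := hR.finrank_direction
  have hN : ∀ x ∈ firstPoints z t, ∀ j, |x.ofLp j| ≤ (N : ℝ) := by
    rintro _ ⟨i, -, rfl⟩ j
    obtain ⟨k, h1, h2, h3⟩ := hz i j
    rw [h3, abs_le]
    have h1' := (Int.cast_le (R := ℝ)).2 h1
    have h2' := (Int.cast_le (R := ℝ)).2 h2
    rw [Int.cast_neg, Int.cast_natCast] at h1'
    rw [Int.cast_natCast] at h2'
    exact ⟨h1', h2'⟩
  simp only [hα, hc, hE, hdim]
  refine ⟨hR.pos, hR.le_one, ?_, ?_, ?_, hR.eq_one, ?_⟩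
  · rintro _ ⟨_, ⟨_, ⟨x, hx, rfl⟩, rfl⟩, rfl⟩
    exact hR.inner_mem x (mem_closedBall_zero_iff.1 hx)
  · refine convexHull_min (fun x hx => ?_) ?_
    · obtain ⟨v, hv, rfl⟩ := hR.outer_mem x hx
      exact ⟨_, ⟨v, mem_closedBall_zero_iff.2 hv, rfl⟩, rfl⟩
    · exact ((convex_closedBall _ _).linear_image _).vadd _
  · intro hdN hm
    refine (hR.one_div_le hN hdN hm).trans ?_
    have hlog : 0 ≤ Real.log ((d : ℝ) * N) :=
      Real.log_nonneg (by exact_mod_cast (by omega : 1 ≤ d * N))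
    gcongr
    norm_num
  · rw [pow_zero, mul_one]
    -- The single step of the initialization is absorbed because t d² ≥ 1.
    have hsum : ∑ i ∈ Finset.range (t + 1), τ i ≤ 6000 * (t * d ^ 2) := by
      rw [Finset.sum_range_succ', hτ0]
      have h1 : ∑ i ∈ Finset.range t, τ (i + 1) ≤ ∑ _i ∈ Finset.range t, 5000 * (d * d) :=
        Finset.sum_le_sum fun i hi => hτ i (by rw [Finset.mem_range] at hi; omega)
      rw [Finset.sum_const, Finset.card_range, smul_eq_mul] at h1
      have h2 : 1 ≤ t * (d * d) := Nat.mul_pos ht1 (Nat.mul_pos hd hd)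
      nlinarith
    exact_mod_cast hsum
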